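/- Gram--Schmidt walk. For an $m\times n$ real matrix $A$ let $X_1=0\in[-1,1]^n$. At step $t$ let $\mathcal A_t=\{i\in[n]: |X_t(i)|<1\}$. If $\mathcal A_t=\emptyset$, stop and output $X_t\in\{-1,1\}^n$. Otherwise let $p_t=\max\mathcal A_t$, let $u_t$ minimise $\|Au\|_2$ over the $u\in\mathbb R^n$ with $u(p_t)=1$ and $u(i)=0$ for $i\notin\mathcal A_t$, let $\Delta_t=\{\delta\in\mathbb R: X_t+\delta u_t\in[-1,1]^n\}$, $\delta^+=|\max\Delta_t|$, $\delta^-=|\min\Delta_t|$, and set $X_{t+1}=X_t+\delta^+u_t$ with (conditional) probability $\delta^- /(\delta^-+\delta^+)$ and $X_{t+1}=X_t-\delta^-u_t$ with probability $\delta^+/(\delta^-+\delta^+)$. The walk stops after at most $n$ steps. Reweighting. Let $M$ be a $d\times n$ real matrix all of whose columns have Euclidean norm at most $1$, and let $\bar X$ be the output of the walk for the $(d+n)\times n$ matrix $2^{-1/2}\binom{M}{\mathrm{Id}_n}$. For $\sigma>0$ and $C\in\mathbb R$ put $B=\{x\in\{\pm1\}^n:\ \|Mx\|_2^2\le C\,\mathbf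 E\|M\bar X\|_2^2\}$, and let $Y=Y_{M,\sigma,C}$ have the law $$\mathbf P(Y\in S)=W^{-1}\,\mathbf E\Big[\mathbf 1_{\bar X\in S\cap B}\exp\Big(\frac{d\|M\bar X\|_2^2}{2\sigma^2n}\Big)\Big],\qquad W=\mathbf E\Big[\mathbf 1_{\bar X\in B}\exp\Big(\frac{d\|M\bar X\|_2^2}{2\sigma^2n}\Big)\Big]$$ (the zero measure if $W=0$). Theorem. Let $C:\mathbb N\to\mathbb R$ satisfy $C(d)\to\infty$ as $d\to\infty$ and $C(d)\le(\log d)^2$ for all large $d$. There is a function $c:\mathbb N\to\mathbb R$, depending only on $C(\cdot)$, with $c(d)\to0$ as $d\to\infty$, which for the choice $C(d)=(\log d)^2$ can be taken of order exactly $1/\log d$, i.e. $c(d)=\Theta(1/\log d)$, such that the following holds. For all $d,n\in\mathbb N$ and reals $\kappa,\sigma\ge1$ with $n=\kappa d\log d$, all $d\times n$ real matrices $M$ whose columns have Euclidean norm at most $1$, and for $R$ a random $d\times n$ matrix with i.i.d. $N(0,\sigma^2/d)$ entries and $\varepsilon=\sigma\sqrt{\log d}\;d^{-\kappa/32}$,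 $$\mathbf P_R\Big(\mathbf P_Y\big(\|(M+R)Y\|_\infty\le\varepsilon\big)>0\Big)\ \ge\ 1-c(d),\qquad Y=Y_{M,\sigma,C(d)},$$ where $\mathbf P_Y$ refers to the law of $Y$ only, with $R$ fixed. -/

import Mathlib

open MeasureTheory ProbabilityTheory Filter Topology Asymptotics
open scoped Matrix

noncomputable section

/-- The Euclidean norm of a real vector (on plain functions `‖·‖` is the supremum norm). -/
def l2norm {ι : Type*} [Fintype ι] (v : ι → ℝ) : ℝ := ‖WithLp.toLp 2 v‖

/-! ### The Gram-Schmidt walk -/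

/-- The set of unfrozen indices of a fractional point `x ∈ [-1, 1]ⁿ`. -/
def gswAlive {n : ℕ} (x : Fin n → ℝ) : Finset (Fin n) := {i | |x i| < 1}

/-- The admissible directions with pivot `p`: vectors `u` with `u p = 1` which vanish on all
frozen coordinates. -/
def gswAdmissible {n : ℕ} (x : Fin n → ℝ) (p : Fin n) : Set (Fin n → ℝ) :=
  {u | u p = 1 ∧ ∀ i, i ∉ gswAlive x → u i = 0}

/-- The direction of the walk, `argmin ‖A u‖₂` over the admissible `u`. A minimiser always exists
when `p` is alive, and it is unique when the columns of `A` are linearly independent. -/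
def gswDirection {m : Type*} [Fintype m] {n : ℕ} (A : Matrix m (Fin n) ℝ) (x : Fin n → ℝ)
    (p : Fin n) : Fin n → ℝ :=
  Classical.epsilon fun u =>
    u ∈ gswAdmissible x p ∧ ∀ u' ∈ gswAdmissible x p, l2norm (A *ᵥ u) ≤ l2norm (A *ᵥ u')

/-- The set `Δ` of step sizes `δ` with `x + δ u ∈ [-1, 1]ⁿ`. -/
def gswSteps {n : ℕ} (x u : Fin n → ℝ) : Set ℝ := {δ | ∀ i, x i + δ * u i ∈ Set.Icc (-1 : ℝ) 1}

/-- `δ⁺ = |max Δ|`. -/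
def gswUp {n : ℕ} (x u : Fin n → ℝ) : ℝ := |sSup (gswSteps x u)|

/-- `δ⁻ = |min Δ|`. -/
def gswDown {n : ℕ} (x u : Fin n → ℝ) : ℝ := |sInf (gswSteps x u)|

/-- The law of the position of the Gram-Schmidt walk of the matrix `A` after at most `k` steps
from `x`. The walk stops when all the coordinates are frozen. Otherwise the pivot is the largest
unfrozen index, `u` is the direction, and the walk moves by `δ⁺ u` with probability
`δ⁻ / (δ⁻ + δ⁺)` and by `-δ⁻ u` with probability `δ⁺ / (δ⁻ + δ⁺)`. -/
def gswLawFrom {m : Type*} [Fintype m] {n : ℕ} (A : Matrix m (Fin n) ℝ) :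
    ℕ → (Fin n → ℝ) → Measure (Fin n → ℝ)
  | 0, x => Measure.dirac x
  | k + 1, x =>
    if h : (gswAlive x).Nonempty then
      let u := gswDirection A x ((gswAlive x).max' h)
      let a := gswUp x u
      let b := gswDown x u
      ENNReal.ofReal (b / (b + a)) • gswLawFrom A k (x + a • u) +
        ENNReal.ofReal (a / (b + a)) • gswLawFrom A k (x - b • u)
    else Measure.dirac x

/-- The law of the output of the Gram-Schmidt walk, started at `0`. Every step freezes at least
one more coordinate and frozen coordinates stay frozen, so the walk stops after at most `n`
steps. -/
def gswLaw {m : Type*} [Fintype m] {n : ℕ} (A : Matrix m (Fin n) ℝ) : Measure (Fin n → ℝ) :=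
  gswLawFrom A n 0

/-! ### The reweighted output -/

/-- The augmented matrix `2^{-1/2} (M; Id)`. -/
def augmented {d n : ℕ} (M : Matrix (Fin d) (Fin n) ℝ) : Matrix (Fin d ⊕ Fin n) (Fin n) ℝ :=
  (Real.sqrt 2)⁻¹ • Matrix.fromRows M 1

/-- The set `B` of sign vectors `x` with `‖M x‖₂² ≤ C E ‖M X̄‖₂²`, where `X̄` is the output of the
Gram-Schmidt walk of the augmented matrix. -/
def goodSigns {d n : ℕ} (M : Matrix (Fin d) (Fin n) ℝ) (C : ℝ) : Set (Fin n → ℝ) :=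
  {x | (∀ i, x i = 1 ∨ x i = -1) ∧
    l2norm (M *ᵥ x) ^ 2 ≤ C * ∫ z, l2norm (M *ᵥ z) ^ 2 ∂(gswLaw (augmented M))}

/-- The law of `Y`: the law of `X̄` restricted to `B`, with density proportional to
`exp (d ‖M x‖₂² / (2 σ² n))`, and normalised. -/
def reweightedLaw {d n : ℕ} (M : Matrix (Fin d) (Fin n) ℝ) (σ C : ℝ) : Measure (Fin n → ℝ) :=
  ((gswLaw (augmented M)).restrict (goodSigns M C)).tilted
    fun x => d * l2norm (M *ᵥ x) ^ 2 / (2 * σ ^ 2 * n)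

/-- The law of a `d × n` array of i.i.d. centred Gaussian entries of variance `σ² / d`. -/
def gaussianMatrixLaw (d n : ℕ) (σ : ℝ) : Measure (Fin d → Fin n → ℝ) :=
  Measure.pi fun _ => Measure.pi fun _ => gaussianReal 0 (σ ^ 2 / d).toNNReal

end

/-! ### The centred two-point law on `{-1, 1}` -/

/-! The proof is a second moment argument weighted by the walk's own output law. Write w(x) for the
probability that the walk outputs x, L = log d and v = σ²n/d, so that Rx has law N(0, v Id) for
every sign vector x. Let F_x(R) (`matrixTest`) be the density, relative to N(0, v Id), of the
uniform law on the cube of half-side ε centred at -Mx, evaluated at Rx. Then E F_x = 1, and F_x ≠ 0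
forces ‖(M+R)x‖∞ ≤ ε. The inverse Gaussian density inside F_x plays the role of the factor
exp(d‖Mx‖²/(2σ²n)). Since only positivity of P_Y is claimed, the exact tilt of Y does not matter
beyond its being positive.

Let Z be the sum of w(x) F_x over the x in B with ‖Mx‖² ≤ dL. Since 2z - z² ≤ 1, P(Z > 0) ≥ 2 E Z -
E Z² (`two_mul_integral_sub_le_measureReal`). Two Markov bounds give E Z ≥ 1 - 1/C - 8/L. For E Z²,
put ρ = ⟨x,y⟩/n. If |ρ| ≤ 1/2, a bivariate Gaussian computation bounds E F_x F_y by the exponential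
of multiples of dρ² and ⟨Mx,My⟩²/(dv²); averaged over x with y fixed, this is 1 + O(1/L) because
⟨x,y⟩ and ⟨Mx,My⟩ are subgaussian. If |ρ| > 1/2, the sup norm of F_y, at most exp(dκ(3 + L/32)), is
beaten by the probability 2 exp(-n/16) = 2 exp(-κdL/16); this is what the exponent κ/32 in ε is for.

The subgaussian input is `integral_exp_gswLaw_le`: if A is injective with columns of norm at most 1,
then E exp⟨AX̄,t⟩ ≤ exp(‖t‖²/2). It follows from a supermartingale, `gswPotential`. With p the
pivot, r the part of its column orthogonal to the span V of the other alive columns, β = ⟨r,t⟩ and h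
= ‖r‖², the potential is exp(‖P_V t‖²/2) exp(β²(1/h - 1)/2) times the moment generating function at
β of the centred two-point law with pivot value x_p. A step with r held fixed preserves it on
average. When other coordinates freeze, r grows by some w ∈ V, and the loss in ‖P_V t‖² pays for the
change of β and h. When the pivot freezes, Pythagoras starts the next phase. -/

lemma sinh_le_mul_cosh {x : ℝ} (hx : 0 ≤ x) : Real.sinh x ≤ x * Real.cosh x := by
  have h : MonotoneOn (fun t : ℝ => t * Real.cosh t - Real.sinh t) (Set.Ici 0) := by
    apply monotoneOn_of_deriv_nonneg (convex_Ici 0) (by fun_prop) (by fun_prop)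
    intro t ht
    rw [interior_Ici, Set.mem_Ioi] at ht
    have : HasDerivAt (fun t : ℝ => t * Real.cosh t - Real.sinh t)
        (1 * Real.cosh t + t * Real.sinh t - Real.cosh t) t :=
      ((hasDerivAt_id t).mul (Real.hasDerivAt_cosh t)).sub (Real.hasDerivAt_sinh t)
    rw [this.deriv]
    have := mul_nonneg ht.le (Real.sinh_nonneg_iff.2 ht.le)
    linarith
  have := h (Set.mem_Ici.2 le_rfl) (Set.mem_Ici.2 hx) hx
  simp at this
  linarith

lemma cosh_add_mul_sinh_pos {y : ℝ} (hy : |y| ≤ 1) (β : ℝ) :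
    0 < Real.cosh β + y * Real.sinh β := by
  obtain ⟨h1, h2⟩ := abs_le.1 hy
  rw [Real.cosh_eq, Real.sinh_eq]
  have e1 := Real.exp_pos β
  have e2 := Real.exp_pos (-β)
  rcases le_or_gt 0 y with h | h
  · nlinarith [mul_nonneg (sub_nonneg.2 h2) e2.le, mul_nonneg h e1.le]
  · nlinarith [mul_nonneg (neg_le_iff_add_nonneg.1 h1) e1.le, mul_pos (neg_pos.2 h) e2]

/-- Tilting the ±1 law of mean y by exp(β·) shifts its mean by (1 - y²) sinh β / (cosh β + y sinh
β); the point is that this shift is at most β. It drives every bound on `twoPointMGF`. -/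
lemma one_sub_sq_mul_sinh_le {y : ℝ} (hy : |y| ≤ 1) {β : ℝ} (hβ : 0 ≤ β) :
    (1 - y ^ 2) * Real.sinh β ≤ β * (Real.cosh β + y * Real.sinh β) := by
  obtain ⟨x, rfl⟩ : ∃ x, β = 2 * x := ⟨β / 2, by ring⟩
  have hx : 0 ≤ x := by linarith
  have hpos := cosh_add_mul_sinh_pos hy (2 * x)
  have hs := sinh_le_mul_cosh hx
  have hc := Real.cosh_pos x
  have hs0 := Real.sinh_nonneg_iff.2 hx
  have hcs := Real.cosh_sq x
  rw [Real.sinh_two_mul, Real.cosh_two_mul] at *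
  set s := Real.sinh x
  set c := Real.cosh x
  -- In terms of the half argument the difference of the two sides is exactly 2s(s + yc)².
  have key : (1 - y ^ 2) * (2 * s * c) * c ≤ 2 * s * (c ^ 2 + s ^ 2 + y * (2 * s * c)) := by
    nlinarith [mul_nonneg hs0 (sq_nonneg (s + y * c))]
  have : (1 - y ^ 2) * (2 * s * c) * c ≤ 2 * x * (c ^ 2 + s ^ 2 + y * (2 * s * c)) * c := by
    refine key.trans ?_
    nlinarith [mul_le_mul_of_nonneg_right hs hpos.le]
  exact le_of_mul_le_mul_right this hc

/-- The moment generating function of the centred two-point law on `{1 - y, -1 - y}`. -/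
noncomputable def twoPointMGF (y β : ℝ) : ℝ :=
  Real.exp (-(β * y)) * (Real.cosh β + y * Real.sinh β)

lemma twoPointMGF_pos {y : ℝ} (hy : |y| ≤ 1) (β : ℝ) : 0 < twoPointMGF y β :=
  mul_pos (Real.exp_pos _) (cosh_add_mul_sinh_pos hy β)

lemma twoPointMGF_neg (y β : ℝ) : twoPointMGF y (-β) = twoPointMGF (-y) β := by
  simp [twoPointMGF]

lemma one_le_twoPointMGF {y : ℝ} (hy : |y| ≤ 1) (β : ℝ) : 1 ≤ twoPointMGF y β := by
  obtain ⟨h1, h2⟩ := abs_le.1 hy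
  have e : twoPointMGF y β = (1 + y) / 2 * Real.exp (β * (1 - y))
      + (1 - y) / 2 * Real.exp (-(β * (1 + y))) := by
    rw [twoPointMGF, Real.cosh_eq, Real.sinh_eq, show β * (1 - y) = -(β * y) + β by ring,
      show -(β * (1 + y)) = -(β * y) + -β by ring, Real.exp_add, Real.exp_add]
    ring
  rw [e]
  have a1 := Real.add_one_le_exp (β * (1 - y))
  have a2 := Real.add_one_le_exp (-(β * (1 + y)))
  have b1 := mul_le_mul_of_nonneg_left a1 (show 0 ≤ (1 + y) / 2 by linarith)
  have b2 := mul_le_mul_of_nonneg_left a2 (show 0 ≤ (1 - y) / 2 by linarith)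
  linarith

/-- Hoeffding's bound: the derivative of the log moment generating function at t ≥ 0 is the shift of
the tilted mean, hence at most t. The symmetry (y, β) ↦ (-y, -β) covers negative β. -/
lemma twoPointMGF_le {y : ℝ} (hy : |y| ≤ 1) (β : ℝ) :
    twoPointMGF y β ≤ Real.exp (β ^ 2 / 2) := by
  wlog hβ : 0 ≤ β generalizing y β
  · have := this (y := -y) (by rwa [abs_neg]) (-β) (by linarith)
    rwa [twoPointMGF_neg, neg_neg, neg_sq] at this
  have hD : ∀ t, HasDerivAt (fun t : ℝ => t ^ 2 / 2 + t * y
      - Real.log (Real.cosh t + y * Real.sinh t))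
      (t + y - (Real.sinh t + y * Real.cosh t) / (Real.cosh t + y * Real.sinh t)) t := by
    intro t
    have h1 := ((Real.hasDerivAt_cosh t).add ((Real.hasDerivAt_sinh t).const_mul y)).log
      (cosh_add_mul_sinh_pos hy t).ne'
    have h2 : HasDerivAt (fun t : ℝ => t ^ 2 / 2 + t * y) (t + y) t := by
      have := ((hasDerivAt_pow 2 t).div_const 2).add ((hasDerivAt_id t).mul_const y)
      refine this.congr_deriv ?_
      norm_num
    exact h2.sub h1
  have h : MonotoneOn (fun t : ℝ => t ^ 2 / 2 + t * y
      - Real.log (Real.cosh t + y * Real.sinh t)) (Set.Ici 0) := by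
    apply monotoneOn_of_deriv_nonneg (convex_Ici 0)
      (fun t _ => (hD t).continuousAt.continuousWithinAt)
      (fun t _ => (hD t).differentiableAt.differentiableWithinAt)
    intro t ht
    rw [interior_Ici, Set.mem_Ioi] at ht
    rw [(hD t).deriv, sub_nonneg, div_le_iff₀ (cosh_add_mul_sinh_pos hy t)]
    have := one_sub_sq_mul_sinh_le hy ht.le
    nlinarith
  have := h (Set.mem_Ici.2 le_rfl) (Set.mem_Ici.2 hβ) hβ
  simp only [Real.cosh_zero, Real.sinh_zero] at this
  norm_num at this
  rw [twoPointMGF, ← Real.exp_log (cosh_add_mul_sinh_pos hy β), ← Real.exp_add]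
  apply Real.exp_le_exp.2
  linarith

/-- Tilting by β turns the law of mean y into the two-point law of mean z, so the left side factors
as `twoPointMGF y β` times exp((z - y)c) times `twoPointMGF z c`. Since z - y lies between 0 and β,
the middle exponent is at most max(0, βc). -/
lemma twoPointMGF_add_le {y : ℝ} (hy : |y| ≤ 1) (β c : ℝ) :
    twoPointMGF y (β + c) ≤ twoPointMGF y β *
      Real.exp (max 0 (β * c) + c ^ 2 / 2) := by
  set D := Real.cosh β + y * Real.sinh β with hDdef
  have hD : 0 < D := cosh_add_mul_sinh_pos hy β
  set z := (Real.sinh β + y * Real.cosh β) / D with hz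
  have hzD : z * D = Real.sinh β + y * Real.cosh β := div_mul_cancel₀ _ hD.ne'
  obtain ⟨h1, h2⟩ := abs_le.1 hy
  have hz1 : |z| ≤ 1 := by
    rw [hz, abs_div, abs_of_pos hD, div_le_one hD, abs_le]
    have e1 := Real.exp_pos β
    have e2 := Real.exp_pos (-β)
    rw [hDdef, Real.cosh_eq, Real.sinh_eq]
    constructor
    · nlinarith [mul_nonneg (neg_le_iff_add_nonneg.1 h1) e1.le]
    · nlinarith [mul_nonneg (sub_nonneg.2 h2) e2.le]
  have hmD : (z - y) * D = (1 - y ^ 2) * Real.sinh β := by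
    rw [sub_mul, hzD, hDdef]; ring
  have hm : (z - y) * c ≤ max 0 (β * c) := by
    have hy2 : 0 ≤ 1 - y ^ 2 := by nlinarith
    rcases le_total 0 β with hβ | hβ
    · have m0 : 0 ≤ z - y := by
        refine nonneg_of_mul_nonneg_left ?_ hD
        rw [hmD]; exact mul_nonneg hy2 (Real.sinh_nonneg_iff.2 hβ)
      have m1 : z - y ≤ β := by
        refine le_of_mul_le_mul_right ?_ hD
        rw [hmD]; exact one_sub_sq_mul_sinh_le hy hβ
      rcases le_total 0 c with hc | hc
      · exact le_max_of_le_right (mul_le_mul_of_nonneg_right m1 hc)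
      · exact le_max_of_le_left (mul_nonpos_of_nonneg_of_nonpos m0 hc)
    · have m0 : z - y ≤ 0 := by
        refine nonpos_of_mul_nonpos_left ?_ hD
        rw [hmD]; exact mul_nonpos_of_nonneg_of_nonpos hy2 (Real.sinh_nonpos_iff.2 hβ)
      have m1 : β ≤ z - y := by
        refine le_of_mul_le_mul_right ?_ hD
        rw [hmD]
        have := one_sub_sq_mul_sinh_le (y := -y) (by rwa [abs_neg]) (neg_nonneg.2 hβ)
        simp only [Real.sinh_neg, Real.cosh_neg] at this
        rw [hDdef]
        linarith
      rcases le_total 0 c with hc | hc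
      · exact le_max_of_le_left (mul_nonpos_of_nonpos_of_nonneg m0 hc)
      · exact le_max_of_le_right (mul_le_mul_of_nonpos_right m1 hc)
  have hfac : twoPointMGF y (β + c)
      = twoPointMGF y β * (Real.exp ((z - y) * c) * twoPointMGF z c) := by
    have : Real.cosh (β + c) + y * Real.sinh (β + c) = D * (Real.cosh c + z * Real.sinh c) := by
      rw [Real.cosh_add, Real.sinh_add]
      linear_combination (-Real.sinh c) * hzD - Real.cosh c * hDdef
    rw [twoPointMGF, this, twoPointMGF, twoPointMGF, show -((β + c) * y) =
      -(β * y) + ((z - y) * c + -(c * z)) by ring, Real.exp_add, Real.exp_add]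
    ring
  rw [hfac, Real.exp_add]
  refine mul_le_mul_of_nonneg_left ?_ (twoPointMGF_pos hy β).le
  exact mul_le_mul (Real.exp_le_exp.2 hm) (twoPointMGF_le hz1 c) (twoPointMGF_pos hz1 c).le
    (Real.exp_pos _).le

/-- After multiplication by exp(βy) the moment generating function is affine in y, hence preserved
by a mean-zero move of y. -/
lemma twoPointMGF_average (y β a b : ℝ) (hab : b + a ≠ 0) :
    b / (b + a) * (Real.exp (a * β) * twoPointMGF (y + a) β) +
      a / (b + a) * (Real.exp (-b * β) * twoPointMGF (y - b) β) = twoPointMGF y β := by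
  have e1 : Real.exp (a * β) * twoPointMGF (y + a) β
      = Real.exp (-(β * y)) * (Real.cosh β + (y + a) * Real.sinh β) := by
    rw [twoPointMGF, ← mul_assoc, ← Real.exp_add]; congr 2; ring
  have e2 : Real.exp (-b * β) * twoPointMGF (y - b) β
      = Real.exp (-(β * y)) * (Real.cosh β + (y - b) * Real.sinh β) := by
    rw [twoPointMGF, ← mul_assoc, ← Real.exp_add]; congr 2; ring
  rw [e1, e2, twoPointMGF]
  field_simp
  ring

/-- The potential of a pivot phase: `y` is the value of the pivot, `β` the inner product of the
test vector with the current step direction, whose squared length is `h`. -/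
noncomputable def pivotPotential (y β h : ℝ) : ℝ :=
  Real.exp (β ^ 2 * (1 / h - 1) / 2) * twoPointMGF y β

lemma one_le_pivotPotential {y β h : ℝ} (hy : |y| ≤ 1) (h0 : 0 < h) (h1 : h ≤ 1) :
    1 ≤ pivotPotential y β h := by
  have : 0 ≤ 1 / h - 1 := by rw [sub_nonneg, le_div_iff₀ h0]; linarith
  exact one_le_mul_of_one_le_of_one_le (Real.one_le_exp (by positivity)) (one_le_twoPointMGF hy β)

lemma pivotPotential_le {y β h : ℝ} (hy : |y| ≤ 1) :
    pivotPotential y β h ≤ Real.exp (β ^ 2 / h / 2) := by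
  refine (mul_le_mul_of_nonneg_left (twoPointMGF_le hy β) (Real.exp_pos _).le).trans ?_
  rw [← Real.exp_add]
  exact Real.exp_le_exp.2 (by ring_nf; rfl)

/-- The cost of lengthening the residual by an orthogonal piece of squared length η that has inner
product c with the test vector. For βc ≥ 0 the exponents differ by the square behind (β+c)²/(h+η) ≤
β²/h + c²/η; for βc < 0 the leftover term has the right sign because h + η ≤ 1. -/
lemma pivotPotential_add_le {y β c h η : ℝ} (hy : |y| ≤ 1) (h0 : 0 < h) (hη : 0 < η)
    (h1 : h + η ≤ 1) :
    pivotPotential y (β + c) (h + η) ≤ Real.exp (c ^ 2 / η / 2) * pivotPotential y β h := by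
  unfold pivotPotential
  refine (mul_le_mul_of_nonneg_left (twoPointMGF_add_le hy β c) (Real.exp_pos _).le).trans ?_
  rw [mul_left_comm, mul_comm, ← mul_assoc, ← Real.exp_add, ← Real.exp_add]
  refine mul_le_mul_of_nonneg_right (Real.exp_le_exp.2 ?_) (twoPointMGF_pos hy β).le
  have hD : 0 < h + η := by positivity
  have id : c ^ 2 / η + β ^ 2 * (1 / h - 1) - (β + c) ^ 2 * (1 / (h + η) - 1) - c ^ 2 - 2 * (β * c)
      = (h * c - η * β) ^ 2 / (h * η * (h + η)) := by
    field_simp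
    ring
  have p : 0 ≤ (h * c - η * β) ^ 2 / (h * η * (h + η)) := by positivity
  rcases le_total 0 (β * c) with hb | hb
  · rw [max_eq_right hb]; linarith
  · rw [max_eq_left hb]
    have id2 : c ^ 2 / η + β ^ 2 * (1 / h - 1) - (β + c) ^ 2 * (1 / (h + η) - 1) - c ^ 2
      = (h * c) ^ 2 / (h * η * (h + η)) + (η * β) ^ 2 / (h * η * (h + η))
        + 2 * (-(β * c)) * (1 / (h + η) - 1) := by
      field_simp
      ring
    have q : 0 ≤ 1 / (h + η) - 1 := by rw [sub_nonneg, le_div_iff₀ hD]; linarith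
    have : 0 ≤ (h * c) ^ 2 / (h * η * (h + η)) + (η * β) ^ 2 / (h * η * (h + η))
        + 2 * (-(β * c)) * (1 / (h + η) - 1) := by
      have := mul_nonneg (show 0 ≤ 2 * (-(β * c)) by linarith) q
      positivity
    linarith

lemma pivotPotential_average (y β h a b : ℝ) (hab : b + a ≠ 0) :
    b / (b + a) * (Real.exp (a * β) * pivotPotential (y + a) β h) +
      a / (b + a) * (Real.exp (-b * β) * pivotPotential (y - b) β h) = pivotPotential y β h := by
  simp only [pivotPotential]
  rw [← twoPointMGF_average y β a b hab]
  ring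

/-! ### Orthogonal projections onto nested subspaces -/

section Projection
variable {E : Type*} [NormedAddCommGroup E] [InnerProductSpace ℝ E]

/-- The left side is the squared length of the projection z of v onto W ⊕ ℝw ⊆ V. As ⟨P_V v, z⟩ =
⟨v, z⟩ = ‖z‖², Cauchy-Schwarz gives ‖z‖ ≤ ‖P_V v‖. For w = 0 the quotient is 0 by convention. -/
lemma norm_sq_starProjection_add_le {V W : Submodule ℝ E} [V.HasOrthogonalProjection]
    [W.HasOrthogonalProjection] (hWV : W ≤ V) (v : E) {w : E} (hw : w ∈ V) (hw' : w ∈ Wᗮ) :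
    ‖W.starProjection v‖ ^ 2 + inner ℝ w v ^ 2 / ‖w‖ ^ 2 ≤ ‖V.starProjection v‖ ^ 2 := by
  set t := inner ℝ w v / ‖w‖ ^ 2 with ht
  set z := W.starProjection v + t • w with hz
  have hzV : z ∈ V := V.add_mem (hWV (W.starProjection_apply_mem v)) (V.smul_mem t hw)
  have hPw : inner ℝ (W.starProjection v) w = 0 := hw' _ (W.starProjection_apply_mem v)
  have htw : t * inner ℝ w v = inner ℝ w v ^ 2 / ‖w‖ ^ 2 := by rw [ht]; ring
  have htt : t ^ 2 * ‖w‖ ^ 2 = inner ℝ w v ^ 2 / ‖w‖ ^ 2 := by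
    rcases eq_or_ne w 0 with rfl | h
    · simp
    · have : ‖w‖ ≠ 0 := norm_ne_zero_iff.2 h
      rw [ht]; field_simp
  have hPv : inner ℝ (W.starProjection v) v = ‖W.starProjection v‖ ^ 2 := by
    have := W.starProjection_inner_eq_zero v _ (W.starProjection_apply_mem v)
    rw [inner_sub_left, real_inner_self_eq_norm_sq, real_inner_comm] at this
    linarith
  have h1 : ‖z‖ ^ 2 = ‖W.starProjection v‖ ^ 2 + inner ℝ w v ^ 2 / ‖w‖ ^ 2 := by
    rw [hz, norm_add_sq_real, inner_smul_right, hPw, norm_smul, mul_pow, Real.norm_eq_abs, sq_abs,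
      htt]
    ring
  have h2 : inner ℝ (V.starProjection v) z = ‖z‖ ^ 2 := by
    have := V.starProjection_inner_eq_zero v z hzV
    rw [inner_sub_left] at this
    rw [h1, ← sub_eq_zero.1 this, real_inner_comm, hz, inner_add_left, inner_smul_left, hPv]
    simp [htw]
  have h3 := real_inner_le_norm (V.starProjection v) z
  rw [← h1]
  rw [h2] at h3
  have : ‖z‖ ≤ ‖V.starProjection v‖ := by
    rcases (norm_nonneg z).eq_or_lt with h | h
    · rw [← h]; exact norm_nonneg _
    · rw [sq] at h3
      exact le_of_mul_le_mul_right h3 h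
  gcongr

lemma norm_sq_starProjection_mono {V W : Submodule ℝ E} [V.HasOrthogonalProjection]
    [W.HasOrthogonalProjection] (hWV : W ≤ V) (v : E) :
    ‖W.starProjection v‖ ^ 2 ≤ ‖V.starProjection v‖ ^ 2 := by
  simpa using norm_sq_starProjection_add_le hWV v (zero_mem V) (zero_mem _)

end Projection

/-! ### One step of the Gram-Schmidt walk -/

section Step
variable {m : Type*} {n : ℕ}

/-- The `j`-th column of `A` as a Euclidean vector. -/
noncomputable def euclideanCol (A : Matrix m (Fin n) ℝ) (j : Fin n) : EuclideanSpace ℝ m :=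
  WithLp.toLp 2 fun i => A i j

/-- The span of the columns of `A` with indices in `S`. -/
noncomputable def colSpan (A : Matrix m (Fin n) ℝ) (S : Finset (Fin n)) :
    Submodule ℝ (EuclideanSpace ℝ m) :=
  Submodule.span ℝ (euclideanCol A '' S)

lemma toLp_mulVec (A : Matrix m (Fin n) ℝ) (u : Fin n → ℝ) :
    WithLp.toLp 2 (A *ᵥ u) = ∑ j, u j • euclideanCol A j := by
  ext i
  simp [euclideanCol, Matrix.mulVec, dotProduct, mul_comm]

lemma colSpan_mono (A : Matrix m (Fin n) ℝ) {S T : Finset (Fin n)} (h : S ⊆ T) :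
    colSpan A S ≤ colSpan A T :=
  Submodule.span_mono (Set.image_mono (by exact_mod_cast h))

lemma euclideanCol_mem_colSpan (A : Matrix m (Fin n) ℝ) {S : Finset (Fin n)} {j : Fin n}
    (h : j ∈ S) : euclideanCol A j ∈ colSpan A S :=
  Submodule.subset_span ⟨j, by exact_mod_cast h, rfl⟩

lemma exists_mulVec_eq_of_mem_colSpan (A : Matrix m (Fin n) ℝ) {S : Finset (Fin n)}
    {z : EuclideanSpace ℝ m} (hz : z ∈ colSpan A S) :
    ∃ c : Fin n → ℝ, (∀ i ∉ S, c i = 0) ∧ WithLp.toLp 2 (A *ᵥ c) = z := by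
  induction hz using Submodule.span_induction with
  | mem x h =>
    obtain ⟨j, hj, rfl⟩ := h
    refine ⟨Pi.single j 1, fun i hi => ?_, ?_⟩
    · rw [Pi.single_eq_of_ne]
      rintro rfl
      exact hi (by exact_mod_cast hj)
    · ext i; simp [euclideanCol]
  | zero => exact ⟨0, fun _ _ => rfl, by simp⟩
  | add x y _ _ hx hy =>
    obtain ⟨c, hc, rfl⟩ := hx
    obtain ⟨c', hc', rfl⟩ := hy
    exact ⟨c + c', fun i hi => by simp [hc i hi, hc' i hi], by rw [Matrix.mulVec_add]; rfl⟩
  | smul t x _ hx =>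
    obtain ⟨c, hc, rfl⟩ := hx
    exact ⟨t • c, fun i hi => by simp [hc i hi], by rw [Matrix.mulVec_smul]; rfl⟩

variable [Fintype m]

/-- The component of the column of `p` orthogonal to the other columns of `S`. -/
noncomputable def pivotResidual (A : Matrix m (Fin n) ℝ) (S : Finset (Fin n)) (p : Fin n) :
    EuclideanSpace ℝ m :=
  euclideanCol A p - (colSpan A (S.erase p)).starProjection (euclideanCol A p)

lemma pivotResidual_mem_orthogonal (A : Matrix m (Fin n) ℝ) (S : Finset (Fin n)) (p : Fin n) :
    pivotResidual A S p ∈ (colSpan A (S.erase p))ᗮ :=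
  Submodule.sub_starProjection_mem_orthogonal _

lemma pivotResidual_mem_colSpan (A : Matrix m (Fin n) ℝ) {S : Finset (Fin n)} {p : Fin n}
    (hp : p ∈ S) : pivotResidual A S p ∈ colSpan A S :=
  Submodule.sub_mem _ (euclideanCol_mem_colSpan A hp)
    (colSpan_mono A (S.erase_subset p) (Submodule.starProjection_apply_mem _ _))

lemma norm_pivotResidual_le (A : Matrix m (Fin n) ℝ) (S : Finset (Fin n)) (p : Fin n) :
    ‖pivotResidual A S p‖ ≤ ‖euclideanCol A p‖ := by
  have := Submodule.norm_sq_eq_add_norm_sq_starProjection (euclideanCol A p)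
    (colSpan A (S.erase p))
  rw [Submodule.starProjection_orthogonal_val] at this
  refine le_of_sq_le_sq ?_ (norm_nonneg _)
  rw [this, pivotResidual]
  nlinarith [sq_nonneg ‖(colSpan A (S.erase p)).starProjection (euclideanCol A p)‖]

/-- Every admissible u has Au = r + z with r the residual and z in the span of the other alive
columns, so ‖Au‖² = ‖r‖² + ‖z‖². The value z = 0 is attained, hence a minimiser exists, and any
choice of minimiser has Au = r. -/
lemma gswDirection_spec (A : Matrix m (Fin n) ℝ) (x : Fin n → ℝ) {p : Fin n}
    (hp : p ∈ gswAlive x) :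
    gswDirection A x p ∈ gswAdmissible x p ∧
      WithLp.toLp 2 (A *ᵥ gswDirection A x p) = pivotResidual A (gswAlive x) p := by
  set S := gswAlive x
  set V := colSpan A (S.erase p)
  set r := pivotResidual A S p with hr
  have dec : ∀ u ∈ gswAdmissible x p, ∃ z ∈ V, WithLp.toLp 2 (A *ᵥ u) = r + z := by
    intro u hu
    refine ⟨∑ j ∈ S.erase p, u j • euclideanCol A j + V.starProjection (euclideanCol A p),
      V.add_mem (V.sum_mem fun j hj => V.smul_mem _ (euclideanCol_mem_colSpan A hj))
        (Submodule.starProjection_apply_mem _ _), ?_⟩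
    rw [toLp_mulVec, ← Finset.sum_subset (Finset.subset_univ S)
      (fun i _ hi => by rw [hu.2 i hi, zero_smul]), ← Finset.add_sum_erase _ _ hp, hu.1, one_smul,
      hr, pivotResidual]
    abel
  have pyth : ∀ z ∈ V, ‖r + z‖ ^ 2 = ‖r‖ ^ 2 + ‖z‖ ^ 2 := by
    intro z hz
    have : inner ℝ r z = 0 := by
      rw [real_inner_comm]; exact pivotResidual_mem_orthogonal A S p z hz
    rw [norm_add_sq_real, this]; ring
  have ex : ∃ u, u ∈ gswAdmissible x p ∧ ∀ u' ∈ gswAdmissible x p,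
      l2norm (A *ᵥ u) ≤ l2norm (A *ᵥ u') := by
    obtain ⟨c, hc, hc'⟩ := exists_mulVec_eq_of_mem_colSpan A
      (Submodule.starProjection_apply_mem V (euclideanCol A p))
    refine ⟨Pi.single p 1 - c, ⟨?_, fun i hi => ?_⟩, fun u' hu' => ?_⟩
    · simp [hc p (by simp)]
    · have : i ≠ p := by rintro rfl; exact hi hp
      have h2 : i ∉ S.erase p := fun h => hi (Finset.mem_of_mem_erase h)
      simp [this, hc i h2]
    · have e : WithLp.toLp 2 (A *ᵥ (Pi.single p 1 - c)) = r := by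
        rw [Matrix.mulVec_sub, WithLp.toLp_sub, hc', hr, pivotResidual]
        congr 1
        ext i; simp [euclideanCol]
      obtain ⟨z, hz, hz'⟩ := dec u' hu'
      rw [l2norm, l2norm, e, hz']
      refine le_of_sq_le_sq ?_ (norm_nonneg _)
      rw [pyth z hz]
      nlinarith [sq_nonneg ‖z‖]
  have sp := Classical.epsilon_spec ex
  change gswDirection A x p ∈ _ ∧ (∀ u' ∈ _, l2norm (A *ᵥ gswDirection A x p) ≤ _) at sp
  refine ⟨sp.1, ?_⟩
  obtain ⟨c, hc, hc'⟩ := exists_mulVec_eq_of_mem_colSpan A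
      (Submodule.starProjection_apply_mem V (euclideanCol A p))
  have e : WithLp.toLp 2 (A *ᵥ (Pi.single p 1 - c)) = r := by
    rw [Matrix.mulVec_sub, WithLp.toLp_sub, hc', hr, pivotResidual]
    congr 1
    ext i; simp [euclideanCol]
  have adm : Pi.single p 1 - c ∈ gswAdmissible x p := by
    refine ⟨by simp [hc p (by simp)], fun i hi => ?_⟩
    have : i ≠ p := by rintro rfl; exact hi hp
    have h2 : i ∉ S.erase p := fun h => hi (Finset.mem_of_mem_erase h)
    simp [this, hc i h2]
  have le := sp.2 _ adm
  obtain ⟨z, hz, hz'⟩ := dec _ sp.1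
  rw [l2norm, l2norm, e, hz'] at le
  have h2 : ‖r + z‖ ^ 2 ≤ ‖r‖ ^ 2 := by gcongr
  rw [pyth z hz] at h2
  have : z = 0 := by
    rw [← norm_eq_zero, ← sq_eq_zero_iff]
    linarith [sq_nonneg ‖z‖]
  rw [hz', this, add_zero]

lemma mem_gswAlive {x : Fin n → ℝ} {i : Fin n} : i ∈ gswAlive x ↔ |x i| < 1 := by
  simp [gswAlive]

/-- The set of admissible steps is compact, because the pivot moves at unit-like rate u p ≠ 0, so
its maximum is attained. If no alive coordinate froze there, a slightly longer step would still be
admissible. A zero step freezes nothing, so the maximum is positive. -/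
lemma gswUp_spec {x u : Fin n → ℝ} {p : Fin n} (hx : ∀ i, |x i| ≤ 1)
    (hup : u p ≠ 0) (hu : ∀ i, i ∉ gswAlive x → u i = 0) :
    0 < gswUp x u ∧ (∀ i, |(x + gswUp x u • u) i| ≤ 1) ∧
      gswAlive (x + gswUp x u • u) ⊂ gswAlive x := by
  have h0 : (0 : ℝ) ∈ gswSteps x u := fun i => by simpa using abs_le.1 (hx i)
  have hcl : IsClosed (gswSteps x u) := by
    have : gswSteps x u = ⋂ i, (fun δ : ℝ => x i + δ * u i) ⁻¹' Set.Icc (-1) 1 := by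
      ext; simp [gswSteps]
    rw [this]
    exact isClosed_iInter fun i => isClosed_Icc.preimage (by fun_prop)
  have hbd : gswSteps x u ⊆ Metric.closedBall 0 (2 / |u p|) := by
    intro δ hδ
    have h1 := abs_le.2 (hδ p)
    have h2 := hx p
    rw [mem_closedBall_zero_iff, Real.norm_eq_abs, le_div_iff₀ (abs_pos.2 hup), ← abs_mul]
    calc |δ * u p| = |(x p + δ * u p) - x p| := by ring_nf
      _ ≤ |x p + δ * u p| + |x p| := abs_sub _ _
      _ ≤ 2 := by linarith
  have hcomp : IsCompact (gswSteps x u) := (isCompact_closedBall _ _).of_isClosed_subset hcl hbd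
  have hmem := hcomp.sSup_mem ⟨0, h0⟩
  have hle : ∀ δ ∈ gswSteps x u, δ ≤ sSup (gswSteps x u) := fun δ hδ => le_csSup hcomp.bddAbove hδ
  have ha : gswUp x u = sSup (gswSteps x u) := abs_of_nonneg (hle 0 h0)
  rw [← ha] at hmem hle
  set a := gswUp x u
  have ha0 : 0 ≤ a := hle 0 h0
  have hcube : ∀ i, |(x + a • u) i| ≤ 1 := fun i => abs_le.2 (hmem i)
  have hsub : gswAlive (x + a • u) ⊆ gswAlive x := by
    intro i hi
    by_contra h
    have := mem_gswAlive.1 hi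
    rw [Pi.add_apply, Pi.smul_apply, hu i h, smul_zero, add_zero] at this
    exact h (mem_gswAlive.2 this)
  have hfr : ¬ gswAlive x ⊆ gswAlive (x + a • u) := by
    intro h
    have ev : ∀ᶠ δ in 𝓝 a, δ ∈ gswSteps x u := by
      refine eventually_all.2 fun i => ?_
      by_cases hi : i ∈ gswAlive x
      · have h1 := abs_lt.1 (mem_gswAlive.1 (h hi))
        have : Tendsto (fun δ : ℝ => x i + δ * u i) (𝓝 a) (𝓝 (x i + a * u i)) :=
          Continuous.tendsto (by fun_prop) a
        exact this (Icc_mem_nhds h1.1 h1.2)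
      · simp only [hu i hi, mul_zero, add_zero]
        exact Eventually.of_forall fun _ => abs_le.1 (hx i)
    obtain ⟨δ, hδ, hδ'⟩ := ((ev.filter_mono nhdsWithin_le_nhds).and
      (self_mem_nhdsWithin : Set.Ioi a ∈ 𝓝[>] a)).exists
    exact absurd (hle δ hδ) (not_le.2 hδ')
  refine ⟨ha0.lt_of_ne ?_, hcube, hsub, hfr⟩
  intro h
  apply hfr
  rw [← h]
  simp

lemma gswDown_eq (x u : Fin n → ℝ) : gswDown x u = gswUp x (-u) := by
  have : gswSteps x (-u) = -gswSteps x u := by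
    ext δ; simp [gswSteps]
  rw [gswDown, gswUp, this, Real.sInf_def, abs_neg]

lemma gswDown_spec {x u : Fin n → ℝ} {p : Fin n} (hx : ∀ i, |x i| ≤ 1)
    (hup : u p ≠ 0) (hu : ∀ i, i ∉ gswAlive x → u i = 0) :
    0 < gswDown x u ∧ (∀ i, |(x - gswDown x u • u) i| ≤ 1) ∧
      gswAlive (x - gswDown x u • u) ⊂ gswAlive x := by
  have := gswUp_spec (u := -u) hx (by simpa using hup) (fun i hi => by simp [hu i hi])
  rw [gswDown_eq]
  simpa only [smul_neg, ← sub_eq_add_neg] using this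

/-- One step of the Gram-Schmidt walk from a point of the cube with an unfrozen coordinate. -/
lemma exists_gswLawFrom_succ (A : Matrix m (Fin n) ℝ) {x : Fin n → ℝ} (hx : ∀ i, |x i| ≤ 1)
    (h : (gswAlive x).Nonempty) : ∃ (u : Fin n → ℝ) (a b : ℝ), 0 < a ∧ 0 < b ∧
      u ((gswAlive x).max' h) = 1 ∧
      WithLp.toLp 2 (A *ᵥ u) = pivotResidual A (gswAlive x) ((gswAlive x).max' h) ∧
      (∀ i, |(x + a • u) i| ≤ 1) ∧ gswAlive (x + a • u) ⊂ gswAlive x ∧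
      (∀ i, |(x - b • u) i| ≤ 1) ∧ gswAlive (x - b • u) ⊂ gswAlive x ∧
      ∀ k, gswLawFrom A (k + 1) x =
        ENNReal.ofReal (b / (b + a)) • gswLawFrom A k (x + a • u) +
          ENNReal.ofReal (a / (b + a)) • gswLawFrom A k (x - b • u) := by
  have hp := (gswAlive x).max'_mem h
  obtain ⟨hadm, hres⟩ := gswDirection_spec A x hp
  obtain ⟨a0, a1, a2⟩ := gswUp_spec hx (by rw [hadm.1]; exact one_ne_zero) hadm.2
  obtain ⟨b0, b1, b2⟩ := gswDown_spec hx (by rw [hadm.1]; exact one_ne_zero) hadm.2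
  exact ⟨_, _, _, a0, b0, hadm.1, hres, a1, a2, b1, b2, fun k => by rw [gswLawFrom, dif_pos h]⟩

lemma gswLawFrom_of_not_nonempty (A : Matrix m (Fin n) ℝ) {x : Fin n → ℝ}
    (h : ¬ (gswAlive x).Nonempty) (k : ℕ) : gswLawFrom A k x = Measure.dirac x := by
  cases k with
  | zero => rfl
  | succ k => rw [gswLawFrom, dif_neg h]

lemma isProbabilityMeasure_gswLawFrom (A : Matrix m (Fin n) ℝ) (k : ℕ) {x : Fin n → ℝ}
    (hx : ∀ i, |x i| ≤ 1) : IsProbabilityMeasure (gswLawFrom A k x) := by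
  induction k generalizing x with
  | zero => rw [gswLawFrom]; infer_instance
  | succ k ih =>
    by_cases h : (gswAlive x).Nonempty
    · obtain ⟨u, a, b, ha, hb, -, -, hxa, -, hxb, -, e⟩ := exists_gswLawFrom_succ A hx h
      have := ih hxa
      have := ih hxb
      constructor
      rw [e, Measure.add_apply, Measure.smul_apply, Measure.smul_apply, measure_univ, measure_univ,
        smul_eq_mul, smul_eq_mul, mul_one, mul_one, ← ENNReal.ofReal_add (by positivity)
        (by positivity), ← add_div, div_self (by positivity), ENNReal.ofReal_one]
    · rw [gswLawFrom_of_not_nonempty A h]; infer_instance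

/-- The law is a finite combination of Dirac masses, so no regularity of f is needed. -/
lemma integrable_gswLawFrom (A : Matrix m (Fin n) ℝ) (k : ℕ) {x : Fin n → ℝ}
    (hx : ∀ i, |x i| ≤ 1) (f : (Fin n → ℝ) → ℝ) : Integrable f (gswLawFrom A k x) := by
  induction k generalizing x with
  | zero => rw [gswLawFrom]; exact integrable_dirac (by simp)
  | succ k ih =>
    by_cases h : (gswAlive x).Nonempty
    · obtain ⟨u, a, b, ha, hb, -, -, hxa, -, hxb, -, e⟩ := exists_gswLawFrom_succ A hx h
      rw [e]
      exact ((ih hxa).smul_measure ENNReal.ofReal_ne_top).add_measure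
        ((ih hxb).smul_measure ENNReal.ofReal_ne_top)
    · rw [gswLawFrom_of_not_nonempty A h]; exact integrable_dirac (by simp)

lemma ae_sign_gswLawFrom (A : Matrix m (Fin n) ℝ) (k : ℕ) {x : Fin n → ℝ}
    (hx : ∀ i, |x i| ≤ 1) (hk : (gswAlive x).card ≤ k) :
    ∀ᵐ z ∂(gswLawFrom A k x), ∀ i, z i = 1 ∨ z i = -1 := by
  induction k generalizing x with
  | zero =>
    rw [gswLawFrom, ae_dirac_eq, Filter.eventually_pure]
    intro i
    have : i ∉ gswAlive x := by
      rw [Finset.card_eq_zero.1 (Nat.le_zero.1 hk)]; simp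
    rw [mem_gswAlive, not_lt] at this
    exact eq_or_eq_neg_of_abs_eq (le_antisymm (hx i) this)
  | succ k ih =>
    by_cases h : (gswAlive x).Nonempty
    · obtain ⟨u, a, b, ha, hb, -, -, hxa, hsa, hxb, hsb, e⟩ := exists_gswLawFrom_succ A hx h
      rw [e, ae_add_measure_iff]
      exact ⟨Measure.ae_smul_measure (ih hxa (by have := Finset.card_lt_card hsa; omega)) _,
        Measure.ae_smul_measure (ih hxb (by have := Finset.card_lt_card hsb; omega)) _⟩
    · rw [gswLawFrom_of_not_nonempty A h, ae_dirac_eq, Filter.eventually_pure]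
      intro i
      have : i ∉ gswAlive x := fun hi => h ⟨i, hi⟩
      rw [mem_gswAlive, not_lt] at this
      exact eq_or_eq_neg_of_abs_eq (le_antisymm (hx i) this)

/-! ### The walk is subgaussian -/

/-- The exponential potential of the walk at `x` with respect to the test vector `v`. -/
noncomputable def gswPotential (A : Matrix m (Fin n) ℝ) (v : EuclideanSpace ℝ m)
    (x : Fin n → ℝ) : ℝ :=
  if h : (gswAlive x).Nonempty then
    let p := (gswAlive x).max' h
    let r := pivotResidual A (gswAlive x) p
    Real.exp (‖(colSpan A ((gswAlive x).erase p)).starProjection v‖ ^ 2 / 2) *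
      pivotPotential (x p) (inner ℝ r v) (‖r‖ ^ 2)
  else 1

/-- By `pivotPotential_le` the pivot contributes at most exp(β²/(2h)), and β²/h is the squared
length of the projection of v onto the residual, which is orthogonal to the other alive columns. -/
lemma gswPotential_le (A : Matrix m (Fin n) ℝ) (v : EuclideanSpace ℝ m) {x : Fin n → ℝ}
    (hx : ∀ i, |x i| ≤ 1) :
    gswPotential A v x ≤ Real.exp (‖(colSpan A (gswAlive x)).starProjection v‖ ^ 2 / 2) := by
  unfold gswPotential
  split_ifs with h
  · have hp := (gswAlive x).max'_mem h
    refine (mul_le_mul_of_nonneg_left (pivotPotential_le (hx _)) (Real.exp_pos _).le).trans ?_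
    rw [← Real.exp_add]
    apply Real.exp_le_exp.2
    have := norm_sq_starProjection_add_le (colSpan_mono A (Finset.erase_subset _ _)) v
      (pivotResidual_mem_colSpan A hp) (pivotResidual_mem_orthogonal A (gswAlive x) _)
    linarith
  · exact Real.one_le_exp (by positivity)

lemma pivotResidual_ne_zero {A : Matrix m (Fin n) ℝ} (hA : ∀ u, A *ᵥ u = 0 → u = 0)
    {S : Finset (Fin n)} (p : Fin n) : pivotResidual A S p ≠ 0 := by
  intro h
  obtain ⟨c, hc, hc'⟩ := exists_mulVec_eq_of_mem_colSpan A
    (Submodule.starProjection_apply_mem (colSpan A (S.erase p)) (euclideanCol A p))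
  have e : WithLp.toLp 2 (A *ᵥ (Pi.single p 1 - c)) = 0 := by
    rw [← h, Matrix.mulVec_sub, WithLp.toLp_sub, hc', pivotResidual]
    congr 1
    ext i; simp [euclideanCol]
  have := congr_fun (hA _ (by simpa using e)) p
  simp [hc p (by simp)] at this

/-- The potential at the new point is compared with the one built from the old subspace and
residual, so that afterwards only the pivot value varies and `pivotPotential_average` applies. -/
lemma gswPotential_step_le {A : Matrix m (Fin n) ℝ} (hA : ∀ u, A *ᵥ u = 0 → u = 0)
    (hcol : ∀ j, ‖euclideanCol A j‖ ≤ 1) (v : EuclideanSpace ℝ m) {x x' : Fin n → ℝ}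
    (hx' : ∀ i, |x' i| ≤ 1) (h : (gswAlive x).Nonempty) (hsub : gswAlive x' ⊆ gswAlive x) :
    gswPotential A v x' ≤
      Real.exp (‖(colSpan A ((gswAlive x).erase ((gswAlive x).max' h))).starProjection v‖ ^ 2 / 2) *
        pivotPotential (x' ((gswAlive x).max' h))
          (inner ℝ (pivotResidual A (gswAlive x) ((gswAlive x).max' h)) v)
          (‖pivotResidual A (gswAlive x) ((gswAlive x).max' h)‖ ^ 2) := by
  set p := (gswAlive x).max' h with hp
  set S := gswAlive x with hS
  set S' := gswAlive x' with hS'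
  set r := pivotResidual A S p with hr
  have hr0 : 0 < ‖r‖ ^ 2 := by
    have := norm_pos_iff.2 (pivotResidual_ne_zero (S := S) hA p); positivity
  have hr1 : ∀ T, ‖pivotResidual A T p‖ ^ 2 ≤ 1 := fun T =>
    pow_le_one₀ (norm_nonneg _) ((norm_pivotResidual_le A T p).trans (hcol p))
  by_cases hpS : p ∈ S'
  · have hne : (gswAlive x').Nonempty := ⟨p, hpS⟩
    have hmax : S'.max' hne = p :=
      le_antisymm (S.le_max' _ (hsub (S'.max'_mem hne))) (S'.le_max' _ hpS)
    rw [gswPotential, dif_pos hne]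
    simp only [← hS', hmax]
    set V := colSpan A (S.erase p)
    set V' := colSpan A (S'.erase p)
    have hVV : V' ≤ V := colSpan_mono A (Finset.erase_subset_erase p hsub)
    set r' := pivotResidual A S' p with hr'
    set w := r' - r with hw
    have hwV : w ∈ V := by
      have : w = V.starProjection (euclideanCol A p) - V'.starProjection (euclideanCol A p) := by
        rw [hw, hr', hr, pivotResidual, pivotResidual]; abel
      rw [this]
      exact V.sub_mem (Submodule.starProjection_apply_mem _ _)
        (hVV (Submodule.starProjection_apply_mem _ _))
    have hwV' : w ∈ V'ᗮ := V'ᗮ.sub_mem (pivotResidual_mem_orthogonal A S' p)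
      (Submodule.orthogonal_le hVV (pivotResidual_mem_orthogonal A S p))
    have hproj := norm_sq_starProjection_add_le hVV v hwV hwV'
    have hrw : inner ℝ r w = 0 := by
      rw [real_inner_comm]
      exact (pivotResidual_mem_orthogonal A S p) w hwV
    have hr'w : r' = r + w := by rw [hw]; abel
    -- If w ≠ 0, the factor exp(⟨w,v⟩²/(2‖w‖²)) from `pivotPotential_add_le` is absorbed by the drop
    -- from ‖P_V v‖² to ‖P_V' v‖².
    rcases eq_or_ne w 0 with h0 | h0
    · rw [hr'w, h0, add_zero]
      refine mul_le_mul_of_nonneg_right (Real.exp_le_exp.2 ?_)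
        (zero_le_one.trans (one_le_pivotPotential (hx' p) hr0 (hr1 S)))
      have := norm_sq_starProjection_mono hVV v
      linarith
    · have hw0 : 0 < ‖w‖ ^ 2 := by have := norm_pos_iff.2 h0; positivity
      have hn : ‖r'‖ ^ 2 = ‖r‖ ^ 2 + ‖w‖ ^ 2 := by
        rw [hr'w, norm_add_sq_real, hrw]; ring
      have hi : inner ℝ r' v = inner ℝ r v + inner ℝ w v := by rw [hr'w, inner_add_left]
      rw [hn, hi]
      refine (mul_le_mul_of_nonneg_left (pivotPotential_add_le (hx' p) hr0 hw0
        (hn ▸ hr1 S')) (Real.exp_pos _).le).trans ?_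
      rw [← mul_assoc, ← Real.exp_add]
      refine mul_le_mul_of_nonneg_right (Real.exp_le_exp.2 ?_)
        (zero_le_one.trans (one_le_pivotPotential (hx' p) hr0 (hr1 S)))
      linarith
  -- The pivot has frozen: all columns still alive lie among the old non-pivot ones, and the old
  -- pivot factor is at least 1.
  · refine (gswPotential_le A v hx').trans ?_
    refine le_mul_of_one_le_right (Real.exp_pos _).le (one_le_pivotPotential (hx' p) hr0 (hr1 S))
      |>.trans' (Real.exp_le_exp.2 ?_)
    have := norm_sq_starProjection_mono (colSpan_mono A (S := S') (T := S.erase p) fun i hi =>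
      Finset.mem_erase.2 ⟨fun h => hpS (h ▸ hi), hsub hi⟩) v
    linarith

lemma one_le_gswPotential {A : Matrix m (Fin n) ℝ} (hA : ∀ u, A *ᵥ u = 0 → u = 0)
    (hcol : ∀ j, ‖euclideanCol A j‖ ≤ 1) (v : EuclideanSpace ℝ m) {x : Fin n → ℝ}
    (hx : ∀ i, |x i| ≤ 1) : 1 ≤ gswPotential A v x := by
  unfold gswPotential
  split_ifs with h
  · refine one_le_mul_of_one_le_of_one_le (Real.one_le_exp (by positivity))
      (one_le_pivotPotential (hx _) ?_ (pow_le_one₀ (norm_nonneg _)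
        ((norm_pivotResidual_le A _ _).trans (hcol _))))
    have := norm_pos_iff.2 (pivotResidual_ne_zero (S := gswAlive x) hA ((gswAlive x).max' h))
    positivity
  · exact le_rfl

lemma integral_exp_gswLawFrom_le {A : Matrix m (Fin n) ℝ} (hA : ∀ u, A *ᵥ u = 0 → u = 0)
    (hcol : ∀ j, ‖euclideanCol A j‖ ≤ 1) (v : EuclideanSpace ℝ m) (k : ℕ) {x : Fin n → ℝ}
    (hx : ∀ i, |x i| ≤ 1) :
    ∫ z, Real.exp (inner ℝ (WithLp.toLp 2 (A *ᵥ (z - x))) v) ∂(gswLawFrom A k x) ≤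
      gswPotential A v x := by
  induction k generalizing x with
  | zero => rw [gswLawFrom]; simpa using one_le_gswPotential hA hcol v hx
  | succ k ih =>
    by_cases h : (gswAlive x).Nonempty
    · obtain ⟨u, a, b, ha, hb, hup, hres, hxa, hsa, hxb, hsb, e⟩ := exists_gswLawFrom_succ A hx h
      rw [e, integral_add_measure
        ((integrable_gswLawFrom A k hxa _).smul_measure ENNReal.ofReal_ne_top)
        ((integrable_gswLawFrom A k hxb _).smul_measure ENNReal.ofReal_ne_top),
        integral_smul_measure, integral_smul_measure, ENNReal.toReal_ofReal (by positivity),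
        ENNReal.toReal_ofReal (by positivity), smul_eq_mul, smul_eq_mul]
      set p := (gswAlive x).max' h with hp
      set r := pivotResidual A (gswAlive x) p with hr
      set W := Real.exp (‖(colSpan A ((gswAlive x).erase p)).starProjection v‖ ^ 2 / 2) with hW
      have shift : ∀ (t : ℝ) (z : Fin n → ℝ),
          Real.exp (inner ℝ (WithLp.toLp 2 (A *ᵥ (z - x))) v) =
            Real.exp (t * inner ℝ r v) *
              Real.exp (inner ℝ (WithLp.toLp 2 (A *ᵥ (z - (x + t • u)))) v) := by
        intro t z
        have e1 : z - x = (z - (x + t • u)) + t • u := by abel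
        rw [e1, Matrix.mulVec_add, WithLp.toLp_add, inner_add_left, Matrix.mulVec_smul,
          WithLp.toLp_smul, hres, inner_smul_left, Real.exp_add, mul_comm]
        simp
      have bound : ∀ (t : ℝ), (∀ i, |(x + t • u) i| ≤ 1) → gswAlive (x + t • u) ⊂ gswAlive x →
          ∫ z, Real.exp (inner ℝ (WithLp.toLp 2 (A *ᵥ (z - x))) v) ∂(gswLawFrom A k (x + t • u)) ≤
            Real.exp (t * inner ℝ r v) * (W * pivotPotential (x p + t) (inner ℝ r v) (‖r‖ ^ 2)) := by
        intro t ht hst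
        simp_rw [shift t]
        rw [integral_const_mul]
        refine mul_le_mul_of_nonneg_left ((ih ht).trans ?_) (Real.exp_pos _).le
        have := gswPotential_step_le hA hcol v ht h hst.subset
        simpa [← hp, hup] using this
      have b1 := bound a hxa hsa
      have b2 := bound (-b) (by simpa [← sub_eq_add_neg] using hxb)
        (by simpa [← sub_eq_add_neg] using hsb)
      simp only [neg_smul, ← sub_eq_add_neg] at b2
      refine (add_le_add (mul_le_mul_of_nonneg_left b1 (by positivity))
        (mul_le_mul_of_nonneg_left b2 (by positivity))).trans (le_of_eq ?_)
      rw [gswPotential, dif_pos h]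
      simp only [← hp, ← hr, ← hW]
      rw [← pivotPotential_average (x p) (inner ℝ r v) (‖r‖ ^ 2) a b (by positivity)]
      ring
    · rw [gswLawFrom_of_not_nonempty A h]
      simpa using one_le_gswPotential hA hcol v hx

/-- The output of the Gram-Schmidt walk is subgaussian with variance proxy `1`. -/
theorem integral_exp_gswLaw_le {A : Matrix m (Fin n) ℝ} (hA : ∀ u, A *ᵥ u = 0 → u = 0)
    (hcol : ∀ j, l2norm (fun i => A i j) ≤ 1) (t : m → ℝ) :
    ∫ z, Real.exp ((A *ᵥ z) ⬝ᵥ t) ∂(gswLaw A) ≤ Real.exp (t ⬝ᵥ t / 2) := by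
  have h0 : ∀ i, |(0 : Fin n → ℝ) i| ≤ 1 := by simp
  have := integral_exp_gswLawFrom_le hA hcol (WithLp.toLp 2 t) n h0
  simp only [sub_zero] at this
  have e : ∀ s : m → ℝ, inner ℝ (WithLp.toLp 2 s) (WithLp.toLp 2 t) = s ⬝ᵥ t := by
    intro s
    simp [PiLp.inner_apply, dotProduct, mul_comm]
  simp only [e] at this
  refine (this.trans (gswPotential_le A _ h0)).trans (Real.exp_le_exp.2 ?_)
  have h1 := Submodule.norm_starProjection_apply_le (colSpan A (gswAlive (0 : Fin n → ℝ)))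
    (WithLp.toLp 2 t)
  have h2 : ‖(WithLp.toLp 2 t : EuclideanSpace ℝ m)‖ ^ 2 = t ⬝ᵥ t := by
    rw [← real_inner_self_eq_norm_sq, e]
  rw [← h2]
  gcongr

end Step

/-! ### Weighted finite sums with subgaussian tails -/

section Subgaussian
variable {α : Type*}

lemma integral_exp_neg_sq_add (a : ℝ) :
    ∫ g : ℝ, Real.exp (-g ^ 2 + 2 * a * g) = Real.sqrt Real.pi * Real.exp (a ^ 2) := by
  have e : ∀ g : ℝ, Real.exp (-g ^ 2 + 2 * a * g)
      = Real.exp (a ^ 2) * Real.exp (-1 * (g - a) ^ 2) := by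
    intro g; rw [← Real.exp_add]; congr 1; ring
  simp_rw [e]
  rw [integral_const_mul, integral_sub_right_eq_self (fun g : ℝ => Real.exp (-1 * g ^ 2)),
    integral_gaussian, div_one, mul_comm]

lemma integrable_exp_neg_sq_add (a : ℝ) :
    Integrable fun g : ℝ => Real.exp (-g ^ 2 + 2 * a * g) := by
  have e : ∀ g : ℝ, Real.exp (-g ^ 2 + 2 * a * g)
      = Real.exp (a ^ 2) * Real.exp (-1 * (g - a) ^ 2) := by
    intro g; rw [← Real.exp_add]; congr 1; ring
  simp_rw [e]
  exact ((integrable_exp_neg_mul_sq one_pos).comp_sub_right a).const_mul _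

/-- A subgaussian variable with variance proxy `2 V` has exponential square moments. -/
lemma sum_mul_exp_mul_sq_le {S : Finset α} {w T : α → ℝ} {V lam : ℝ}
    (hT : ∀ τ : ℝ, ∑ x ∈ S, w x * Real.exp (τ * T x) ≤ Real.exp (τ ^ 2 * V))
    (hV : 0 ≤ V) (hlam : 0 ≤ lam) (h : 4 * lam * V < 1) :
    ∑ x ∈ S, w x * Real.exp (lam * T x ^ 2) ≤ 1 / (1 - 4 * lam * V) := by
  set q := 1 - 4 * lam * V with hq
  have hq0 : 0 < q := by linarith
  have hq1 : q ≤ 1 := by have := mul_nonneg (mul_nonneg zero_le_four hlam) hV; linarith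
  have hpi : 0 < Real.sqrt Real.pi := Real.sqrt_pos.2 Real.pi_pos
  -- Gaussian linearisation of the square: √π exp(λT²) = ∫ exp(-g² + 2√λ T g) dg, after which the
  -- hypothesis applies with τ = 2√λ g.
  have h1 : Real.sqrt Real.pi * ∑ x ∈ S, w x * Real.exp (lam * T x ^ 2) =
      ∫ g : ℝ, ∑ x ∈ S, w x * Real.exp (-g ^ 2 + 2 * (Real.sqrt lam * T x) * g) := by
    rw [integral_finsetSum _ fun x _ => (integrable_exp_neg_sq_add _).const_mul _,
      Finset.mul_sum]
    refine Finset.sum_congr rfl fun x _ => ?_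
    rw [integral_const_mul, integral_exp_neg_sq_add, mul_pow, Real.sq_sqrt hlam]
    ring
  have h2 : ∫ g : ℝ, ∑ x ∈ S, w x * Real.exp (-g ^ 2 + 2 * (Real.sqrt lam * T x) * g) ≤
      ∫ g : ℝ, Real.exp (-q * g ^ 2) := by
    refine integral_mono
      (integrable_finsetSum _ fun x _ => (integrable_exp_neg_sq_add _).const_mul _)
      (integrable_exp_neg_mul_sq hq0) fun g => ?_
    have e : ∀ x, w x * Real.exp (-g ^ 2 + 2 * (Real.sqrt lam * T x) * g)
        = Real.exp (-g ^ 2) * (w x * Real.exp ((2 * Real.sqrt lam * g) * T x)) := by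
      intro x; rw [Real.exp_add, mul_left_comm]; congr 3; ring
    simp only [e, ← Finset.mul_sum]
    refine (mul_le_mul_of_nonneg_left (hT _) (Real.exp_pos _).le).trans (le_of_eq ?_)
    rw [← Real.exp_add, mul_pow, mul_pow, Real.sq_sqrt hlam, hq]
    congr 1; ring
  rw [integral_gaussian, ← h1, Real.sqrt_div Real.pi_pos.le] at h2
  have h3 : ∑ x ∈ S, w x * Real.exp (lam * T x ^ 2) ≤ 1 / Real.sqrt q := by
    refine le_of_mul_le_mul_left (h2.trans (le_of_eq ?_)) hpi
    ring
  -- Since q ≤ 1, 1/√q may be weakened to 1/q.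
  refine h3.trans (one_div_le_one_div_of_le hq0 ?_)
  rw [Real.le_sqrt hq0.le hq0.le]
  nlinarith

lemma sum_mul_sq_le {S : Finset α} {w T : α → ℝ}
    (hw : ∀ x ∈ S, 0 ≤ w x) (hw1 : ∑ x ∈ S, w x = 1)
    (hT : ∀ τ : ℝ, ∑ x ∈ S, w x * Real.exp (τ * T x) ≤ Real.exp (τ ^ 2)) :
    ∑ x ∈ S, w x * T x ^ 2 ≤ 8 := by
  -- With λ = 1/8 the exponential moment is at most 2, and 1 + t ≤ exp t then gives E T²/8 ≤ 1.
  have h1 := sum_mul_exp_mul_sq_le (V := 1) (lam := 1 / 8) (by simpa using hT) zero_le_one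
    (by norm_num) (by norm_num)
  have h2 : ∑ x ∈ S, w x * (1 / 8 * T x ^ 2 + 1) ≤ ∑ x ∈ S, w x * Real.exp (1 / 8 * T x ^ 2) :=
    Finset.sum_le_sum fun x hx => mul_le_mul_of_nonneg_left (Real.add_one_le_exp _) (hw x hx)
  simp only [mul_add, mul_one, Finset.sum_add_distrib, hw1] at h2
  have e : ∑ x ∈ S, w x * (1 / 8 * T x ^ 2) = 1 / 8 * ∑ x ∈ S, w x * T x ^ 2 := by
    rw [Finset.mul_sum]; exact Finset.sum_congr rfl fun x _ => by ring
  rw [e] at h2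
  norm_num at h1 h2
  linarith

lemma sum_filter_lt_abs_le {S : Finset α} {w T : α → ℝ} {V s : ℝ}
    (hw : ∀ x ∈ S, 0 ≤ w x)
    (hT : ∀ τ : ℝ, ∑ x ∈ S, w x * Real.exp (τ * T x) ≤ Real.exp (τ ^ 2 * V))
    (hV : 0 < V) (hs : 0 ≤ s) :
    ∑ x ∈ S with s < |T x|, w x ≤ 2 * Real.exp (-(s ^ 2 / (4 * V))) := by
  -- The minimiser of τ²V - τs in the Chernoff bound.
  set τ := s / (2 * V) with hτ
  have hτ0 : 0 ≤ τ := by positivity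
  have h1 : ∑ x ∈ S with s < |T x|, w x ≤
      ∑ x ∈ S, w x * (Real.exp (-(τ * s)) * (Real.exp (τ * T x) + Real.exp (-τ * T x))) := by
    rw [Finset.sum_filter]
    refine Finset.sum_le_sum fun x hx => ?_
    have p1 := Real.exp_pos (τ * T x)
    have p2 := Real.exp_pos (-τ * T x)
    split_ifs with h
    · refine le_mul_of_one_le_right (hw x hx) ?_
      have : Real.exp (τ * s) ≤ Real.exp (τ * T x) + Real.exp (-τ * T x) := by
        rcases lt_abs.1 h with h | h
        · have := Real.exp_le_exp.2 (mul_le_mul_of_nonneg_left h.le hτ0)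
          linarith
        · have := Real.exp_le_exp.2 (mul_le_mul_of_nonneg_left h.le hτ0)
          rw [mul_neg, ← neg_mul] at this
          linarith
      calc 1 = Real.exp (-(τ * s)) * Real.exp (τ * s) := by rw [← Real.exp_add]; simp
        _ ≤ _ := mul_le_mul_of_nonneg_left this (Real.exp_pos _).le
    · have := hw x hx
      positivity
  have h2 : ∑ x ∈ S, w x * (Real.exp (-(τ * s)) * (Real.exp (τ * T x) + Real.exp (-τ * T x))) =
      Real.exp (-(τ * s)) * (∑ x ∈ S, w x * Real.exp (τ * T x) +
        ∑ x ∈ S, w x * Real.exp (-τ * T x)) := by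
    rw [← Finset.sum_add_distrib, Finset.mul_sum]
    exact Finset.sum_congr rfl fun x _ => by ring
  rw [h2] at h1
  have a := hT τ
  have b := hT (-τ)
  rw [neg_sq] at b
  refine h1.trans ((mul_le_mul_of_nonneg_left (add_le_add a b) (Real.exp_pos _).le).trans
    (le_of_eq ?_))
  rw [← two_mul, mul_left_comm, ← Real.exp_add]
  congr 2
  rw [hτ]; field_simp; ring

end Subgaussian

/-! ### The output law as a weighted sum over sign vectors -/

/-- The finite set of sign vectors. -/
noncomputable def signVectors (n : ℕ) : Finset (Fin n → ℝ) := Fintype.piFinset fun _ => {1, -1}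

lemma mem_signVectors {n : ℕ} {x : Fin n → ℝ} :
    x ∈ signVectors n ↔ ∀ i, x i = 1 ∨ x i = -1 := by
  simp [signVectors]

lemma dotProduct_self_of_mem_signVectors {n : ℕ} {x : Fin n → ℝ} (hx : x ∈ signVectors n) :
    x ⬝ᵥ x = n := by
  have : ∀ i, x i * x i = 1 := fun i => by
    rcases mem_signVectors.1 hx i with h | h <;> rw [h] <;> norm_num
  simp [dotProduct, this]

section Law
variable {m : Type*} [Fintype m] {n : ℕ}

instance isProbabilityMeasure_gswLaw (A : Matrix m (Fin n) ℝ) : IsProbabilityMeasure (gswLaw A) :=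
  isProbabilityMeasure_gswLawFrom A n (by simp)

lemma ae_mem_signVectors (A : Matrix m (Fin n) ℝ) :
    ∀ᵐ z ∂(gswLaw A), z ∈ (signVectors n : Set (Fin n → ℝ)) := by
  filter_upwards [ae_sign_gswLawFrom A n (x := 0) (by simp)
    ((Finset.card_le_univ _).trans (by simp))] with z hz
  exact Finset.mem_coe.2 (mem_signVectors.2 hz)

lemma integral_gswLaw (A : Matrix m (Fin n) ℝ) (f : (Fin n → ℝ) → ℝ) :
    ∫ z, f z ∂(gswLaw A) = ∑ x ∈ signVectors n, (gswLaw A).real {x} * f x := by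
  have h := Measure.restrict_eq_self_of_ae_mem (ae_mem_signVectors A)
  have hint : Integrable f (gswLaw A) := integrable_gswLawFrom A n (by simp) f
  conv_lhs => rw [← h]
  rw [setIntegral_finset _ hint.integrableOn]
  rfl

end Law

section Augmented
variable {d n : ℕ} (M : Matrix (Fin d) (Fin n) ℝ)

lemma augmented_mulVec (z : Fin n → ℝ) :
    augmented M *ᵥ z = (Real.sqrt 2)⁻¹ • Sum.elim (M *ᵥ z) z := by
  rw [augmented, Matrix.smul_mulVec, Matrix.fromRows_mulVec, Matrix.one_mulVec]

lemma l2norm_sq {ι : Type*} [Fintype ι] (v : ι → ℝ) : l2norm v ^ 2 = v ⬝ᵥ v := by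
  rw [l2norm, EuclideanSpace.norm_sq_eq]
  simp [dotProduct, sq]

/-- The identity block makes the matrix injective and X̄ itself subgaussian, while the block M does
the same for MX̄. The scaling keeps columns in the unit ball; testing against √2(s,t) cancels it. -/
lemma integral_exp_gswLaw_augmented_le (hM : ∀ j, l2norm (fun i => M i j) ≤ 1)
    (s : Fin d → ℝ) (t : Fin n → ℝ) :
    ∫ z, Real.exp ((M *ᵥ z) ⬝ᵥ s + z ⬝ᵥ t) ∂(gswLaw (augmented M)) ≤
      Real.exp (s ⬝ᵥ s + t ⬝ᵥ t) := by
  have h2 : (0 : ℝ) < Real.sqrt 2 := by positivity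
  have hsq : Real.sqrt 2 * Real.sqrt 2 = 2 := Real.mul_self_sqrt zero_le_two
  have hA : ∀ u, augmented M *ᵥ u = 0 → u = 0 := by
    intro u hu
    rw [augmented_mulVec, smul_eq_zero] at hu
    have := hu.resolve_left (by positivity)
    ext i
    simpa using congr_fun this (Sum.inr i)
  have hcol : ∀ j, l2norm (fun i => augmented M i j) ≤ 1 := by
    intro j
    have hn := hM j
    have h0 : 0 ≤ l2norm (fun i => M i j) := norm_nonneg _
    refine le_of_sq_le_sq ?_ zero_le_one
    have h3 : l2norm (fun i => M i j) ^ 2 ≤ 1 := by nlinarith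
    rw [l2norm_sq] at h3 ⊢
    simp only [dotProduct, augmented, Matrix.smul_apply, smul_eq_mul, Fintype.sum_sum_type,
      Matrix.fromRows_apply_inl, Matrix.fromRows_apply_inr, Matrix.one_apply] at h3 ⊢
    have e : ∀ a : ℝ, (Real.sqrt 2)⁻¹ * a * ((Real.sqrt 2)⁻¹ * a) = (a * a) / 2 := by
      intro a
      rw [mul_mul_mul_comm, ← mul_inv, hsq]; ring
    simp only [e, ← Finset.sum_div]
    simp
    linarith
  have := integral_exp_gswLaw_le hA hcol (Real.sqrt 2 • Sum.elim s t)
  have e : ∀ (f : Fin d → ℝ) (g : Fin n → ℝ), Sum.elim f g ⬝ᵥ Sum.elim s t = f ⬝ᵥ s + g ⬝ᵥ t := by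
    intro f g; simp [dotProduct]
  simp only [augmented_mulVec, smul_dotProduct, dotProduct_smul, e, smul_eq_mul] at this
  convert this using 3
  · rw [← mul_assoc, mul_inv_cancel₀ h2.ne', one_mul]
  · rw [← mul_assoc, hsq]; ring

/-- The probability of the sign vector `x` under the walk of the augmented matrix. -/
noncomputable def gswWeight (x : Fin n → ℝ) : ℝ := (gswLaw (augmented M)).real {x}

lemma gswWeight_nonneg (x : Fin n → ℝ) : 0 ≤ gswWeight M x := measureReal_nonneg

lemma sum_gswWeight : ∑ x ∈ signVectors n, gswWeight M x = 1 := by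
  have := integral_gswLaw (augmented M) fun _ => 1
  simpa [gswWeight] using this.symm

lemma sum_gswWeight_mul_exp_mulVec_le (hM : ∀ j, l2norm (fun i => M i j) ≤ 1)
    (s : Fin d → ℝ) (τ : ℝ) :
    ∑ x ∈ signVectors n, gswWeight M x * Real.exp (τ * ((M *ᵥ x) ⬝ᵥ s)) ≤
      Real.exp (τ ^ 2 * (s ⬝ᵥ s)) := by
  have := integral_exp_gswLaw_augmented_le M hM (τ • s) 0
  rw [integral_gswLaw] at this
  simpa [gswWeight, sq, mul_assoc] using this

lemma sum_gswWeight_mul_exp_le (hM : ∀ j, l2norm (fun i => M i j) ≤ 1)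
    (t : Fin n → ℝ) (τ : ℝ) :
    ∑ x ∈ signVectors n, gswWeight M x * Real.exp (τ * (x ⬝ᵥ t)) ≤
      Real.exp (τ ^ 2 * (t ⬝ᵥ t)) := by
  have := integral_exp_gswLaw_augmented_le M hM 0 (τ • t)
  rw [integral_gswLaw] at this
  simpa [gswWeight, sq, mul_assoc] using this

lemma sum_gswWeight_mul_sq_le (hM : ∀ j, l2norm (fun i => M i j) ≤ 1) :
    ∑ x ∈ signVectors n, gswWeight M x * l2norm (M *ᵥ x) ^ 2 ≤ 8 * d := by
  have h : ∀ i : Fin d, ∑ x ∈ signVectors n, gswWeight M x * (M *ᵥ x) i ^ 2 ≤ 8 := fun i =>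
    sum_mul_sq_le (fun x _ => gswWeight_nonneg M x) (sum_gswWeight M) fun τ => by
      simpa using sum_gswWeight_mul_exp_mulVec_le M hM (Pi.single i 1) τ
  have e : ∑ x ∈ signVectors n, gswWeight M x * l2norm (M *ᵥ x) ^ 2
      = ∑ i, ∑ x ∈ signVectors n, gswWeight M x * (M *ᵥ x) i ^ 2 := by
    rw [Finset.sum_comm]
    refine Finset.sum_congr rfl fun x _ => ?_
    rw [l2norm_sq, dotProduct, Finset.mul_sum]
    simp [sq]
  rw [e]
  refine (Finset.sum_le_sum fun i _ => h i).trans ?_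
  simp [mul_comm]

end Augmented

/-! ### Test functions of the cube under Gaussian noise -/

section OneDim
open NNReal

/-- The density of a uniform point of `[-a - ε, -a + ε]` relative to `N(0, v)`. -/
noncomputable def cubeTest (v : ℝ≥0) (ε a t : ℝ) : ℝ :=
  (Set.Icc (-a - ε) (-a + ε)).indicator (fun t => (2 * ε * gaussianPDFReal 0 v t)⁻¹) t

lemma cubeTest_nonneg {v : ℝ≥0} {ε : ℝ} (hε : 0 < ε) (a t : ℝ) : 0 ≤ cubeTest v ε a t :=
  Set.indicator_nonneg (fun t _ => by
    have := gaussianPDFReal_nonneg 0 v t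
    positivity) _

@[fun_prop]
lemma measurable_cubeTest (v : ℝ≥0) (ε a : ℝ) : Measurable (cubeTest v ε a) :=
  (((measurable_gaussianPDFReal 0 v).const_mul _).inv).indicator measurableSet_Icc

lemma abs_add_le_of_cubeTest_ne_zero {v : ℝ≥0} {ε a t : ℝ} (h : cubeTest v ε a t ≠ 0) :
    |a + t| ≤ ε := by
  have := Set.mem_of_indicator_ne_zero h
  rw [abs_le]
  constructor <;> linarith [this.1, this.2]

lemma sq_le_of_mem_Icc {ε a t : ℝ} (h : t ∈ Set.Icc (-a - ε) (-a + ε)) :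
    t ^ 2 ≤ 2 * a ^ 2 + 2 * ε ^ 2 := by
  have h1 : (t + a) ^ 2 ≤ ε ^ 2 := sq_le_sq' (by linarith [h.1]) (by linarith [h.2])
  nlinarith [sq_nonneg (t + 2 * a)]

lemma pdf_mul_cubeTest {v : ℝ≥0} (hv : v ≠ 0) (ε a t : ℝ) :
    gaussianPDFReal 0 v t * cubeTest v ε a t =
      (Set.Icc (-a - ε) (-a + ε)).indicator (fun _ => (2 * ε)⁻¹) t := by
  unfold cubeTest
  by_cases h : t ∈ Set.Icc (-a - ε) (-a + ε)
  · rw [Set.indicator_of_mem h, Set.indicator_of_mem h, mul_inv, mul_left_comm,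
      mul_inv_cancel₀ (gaussianPDFReal_pos 0 v t hv).ne', mul_one]
  · rw [Set.indicator_of_notMem h, Set.indicator_of_notMem h, mul_zero]

lemma cubeTest_le {v : ℝ≥0} (hv : v ≠ 0) {ε : ℝ} (hε : 0 < ε) (a t : ℝ) :
    cubeTest v ε a t ≤ Real.sqrt (2 * Real.pi * v) / (2 * ε) *
      Real.exp ((a ^ 2 + ε ^ 2) / v) := by
  have hv0 : (0 : ℝ) < v := by positivity
  unfold cubeTest
  by_cases ht : t ∈ Set.Icc (-a - ε) (-a + ε)
  swap
  · rw [Set.indicator_of_notMem ht]; positivity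
  have e : (2 * ε * gaussianPDFReal 0 v t)⁻¹
      = Real.sqrt (2 * Real.pi * v) / (2 * ε) * Real.exp (t ^ 2 / (2 * v)) := by
    rw [gaussianPDFReal, mul_inv, mul_inv _ (Real.exp _), inv_inv, ← Real.exp_neg, sub_zero,
      neg_div, neg_neg]
    ring
  rw [Set.indicator_of_mem ht, e]
  refine mul_le_mul_of_nonneg_left (Real.exp_le_exp.2 ?_) (by positivity)
  rw [div_le_div_iff₀ (by positivity) hv0]
  nlinarith [mul_le_mul_of_nonneg_right (sq_le_of_mem_Icc ht) hv0.le]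

lemma integral_cubeTest {v : ℝ≥0} (hv : v ≠ 0) {ε : ℝ} (hε : 0 < ε) (a : ℝ) :
    ∫ t, cubeTest v ε a t ∂(gaussianReal 0 v) = 1 := by
  rw [integral_gaussianReal_eq_integral_smul hv]
  simp_rw [smul_eq_mul, pdf_mul_cubeTest hv]
  rw [integral_indicator measurableSet_Icc, setIntegral_const, smul_eq_mul, measureReal_def,
    Real.volume_Icc, ENNReal.toReal_ofReal (by linarith)]
  field_simp
  ring

/-- The moment generating function of a uniform variable on an interval: centring and symmetrising
turn the exponential into cosh(st) ≤ exp(s²t²/2). -/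
lemma setIntegral_exp_mul_le {ε : ℝ} (hε : 0 < ε) (a s : ℝ) :
    ∫ t in Set.Icc (-a - ε) (-a + ε), (2 * ε)⁻¹ * Real.exp (s * t) ≤
      Real.exp (-s * a + s ^ 2 * ε ^ 2 / 2) := by
  have hle : -a - ε ≤ -a + ε := by linarith
  rw [integral_Icc_eq_integral_Ioc, ← intervalIntegral.integral_of_le hle,
    intervalIntegral.integral_const_mul]
  have h1 : ∫ t in (-a - ε)..(-a + ε), Real.exp (s * t)
      = Real.exp (-s * a) * ∫ t in (-ε)..ε, Real.exp (s * t) := by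
    have := intervalIntegral.integral_comp_sub_right (a := -ε) (b := ε)
      (fun t => Real.exp (s * t)) a
    rw [show -ε - a = -a - ε by ring, show ε - a = -a + ε by ring] at this
    rw [← this, ← intervalIntegral.integral_const_mul]
    refine intervalIntegral.integral_congr fun t _ => ?_
    simp only [← Real.exp_add]
    congr 1; ring
  have h2 : ∫ t in (-ε)..ε, Real.exp (s * t) = ∫ t in (-ε)..ε, Real.exp (-(s * t)) := by
    have := intervalIntegral.integral_comp_neg (a := -ε) (b := ε) (fun t => Real.exp (s * t))
    simp only [neg_neg, mul_neg] at this
    exact this.symm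
  have h3 : ∫ t in (-ε)..ε, Real.exp (s * t) = ∫ t in (-ε)..ε, Real.cosh (s * t) := by
    have : ∫ t in (-ε)..ε, Real.cosh (s * t)
        = ∫ t in (-ε)..ε, (Real.exp (s * t) + Real.exp (-(s * t))) / 2 :=
      intervalIntegral.integral_congr fun t _ => Real.cosh_eq _
    rw [this, intervalIntegral.integral_div, intervalIntegral.integral_add
      (Continuous.intervalIntegrable (by fun_prop) _ _)
      (Continuous.intervalIntegrable (by fun_prop) _ _), ← h2]
    ring
  have h4 : ∫ t in (-ε)..ε, Real.cosh (s * t) ≤ ∫ _t in (-ε)..ε, Real.exp (s ^ 2 * ε ^ 2 / 2) := by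
    refine intervalIntegral.integral_mono_on (by linarith)
      (Continuous.intervalIntegrable (by fun_prop) _ _) (by simp) fun t ht => ?_
    refine (Real.cosh_le_exp_half_sq _).trans (Real.exp_le_exp.2 ?_)
    have : t ^ 2 ≤ ε ^ 2 := sq_le_sq' ht.1 ht.2
    rw [mul_pow]
    gcongr
  rw [intervalIntegral.integral_const, smul_eq_mul] at h4
  rw [h1, h3, Real.exp_add, mul_left_comm]
  refine mul_le_mul_of_nonneg_left ?_ (Real.exp_pos _).le
  rw [inv_mul_le_iff₀ (by positivity)]
  refine h4.trans (le_of_eq (by ring))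

/-- A bound on the conditional density of one of two ρ-correlated Gaussians given the other. The
discarded exponent is a multiple of ρ²(u² + t² - 2ρut) ≥ 0. -/
lemma gaussianPDFReal_sub_mul_le {v v' : ℝ≥0} (hv : v ≠ 0) {ρ : ℝ} (hρ : ρ ^ 2 < 1)
    (hv' : (v' : ℝ) = (1 - ρ ^ 2) * v) (u t : ℝ) :
    gaussianPDFReal 0 v' (t - ρ * u) ≤
      (Real.sqrt (1 - ρ ^ 2))⁻¹ * Real.exp (ρ * u / v * t) * gaussianPDFReal 0 v t := by
  have hv0 : (0 : ℝ) < v := by positivity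
  have hq : 0 < 1 - ρ ^ 2 := by linarith
  rw [gaussianPDFReal, gaussianPDFReal, hv', mul_left_comm, Real.sqrt_mul hq.le, mul_inv,
    mul_mul_mul_comm, mul_assoc _ _ (Real.exp _), ← Real.exp_add]
  rw [mul_assoc, mul_assoc]
  refine mul_le_mul_of_nonneg_left (mul_le_mul_of_nonneg_left (Real.exp_le_exp.2 ?_)
    (by positivity)) (by positivity)
  rw [sub_zero, sub_zero, ← sub_nonneg]
  have : ρ * u / v * t + -t ^ 2 / (2 * v) - -(t - ρ * u) ^ 2 / (2 * ((1 - ρ ^ 2) * v))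
      = ρ ^ 2 * (u ^ 2 + t ^ 2 - 2 * ρ * u * t) / (2 * ((1 - ρ ^ 2) * v)) := by
    field_simp
    ring
  rw [this]
  have : 0 ≤ u ^ 2 + t ^ 2 - 2 * ρ * u * t := by
    nlinarith [sq_nonneg (u - ρ * t), mul_nonneg hq.le (sq_nonneg t)]
  positivity

lemma integral_cubeTest_add_le {v v' : ℝ≥0} (hv : v ≠ 0) (hv'0 : v' ≠ 0) {ρ : ℝ} (hρ : ρ ^ 2 < 1)
    (hv' : (v' : ℝ) = (1 - ρ ^ 2) * v) {ε : ℝ} (hε : 0 < ε) (b u : ℝ) :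
    ∫ w, cubeTest v ε b (ρ * u + w) ∂(gaussianReal 0 v') ≤
      (Real.sqrt (1 - ρ ^ 2))⁻¹ *
        Real.exp (-(ρ * u / v) * b + (ρ * u / v) ^ 2 * ε ^ 2 / 2) := by
  rw [integral_gaussianReal_eq_integral_smul hv'0]
  have h1 : ∫ w, gaussianPDFReal 0 v' w • cubeTest v ε b (ρ * u + w)
      = ∫ t, gaussianPDFReal 0 v' (t - ρ * u) * cubeTest v ε b t := by
    rw [← integral_sub_right_eq_self _ (ρ * u)]
    simp
  rw [h1]
  have h2 : ∀ t, gaussianPDFReal 0 v' (t - ρ * u) * cubeTest v ε b t ≤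
      (Set.Icc (-b - ε) (-b + ε)).indicator
        (fun t => (Real.sqrt (1 - ρ ^ 2))⁻¹ * ((2 * ε)⁻¹ * Real.exp (ρ * u / v * t))) t := by
    intro t
    refine (mul_le_mul_of_nonneg_right (gaussianPDFReal_sub_mul_le hv hρ hv' u t)
      (cubeTest_nonneg hε b t)).trans (le_of_eq ?_)
    rw [mul_assoc, pdf_mul_cubeTest hv]
    by_cases h : t ∈ Set.Icc (-b - ε) (-b + ε)
    · rw [Set.indicator_of_mem h, Set.indicator_of_mem h]; ring
    · rw [Set.indicator_of_notMem h, Set.indicator_of_notMem h, mul_zero]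
  have hi : Integrable ((Set.Icc (-b - ε) (-b + ε)).indicator
      (fun t => (Real.sqrt (1 - ρ ^ 2))⁻¹ * ((2 * ε)⁻¹ * Real.exp (ρ * u / v * t)))) :=
    (ContinuousOn.integrableOn_compact isCompact_Icc (by fun_prop)).integrable_indicator
      measurableSet_Icc
  refine (integral_mono_of_nonneg (ae_of_all _ fun t => mul_nonneg (gaussianPDFReal_nonneg _ _ _)
    (cubeTest_nonneg hε b t)) hi (ae_of_all _ h2)).trans ?_
  rw [integral_indicator measurableSet_Icc, integral_const_mul]
  exact mul_le_mul_of_nonneg_left (setIntegral_exp_mul_le hε b _) (by positivity)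

/-- Integrating out the second variable leaves a uniform average over u of an exponential linear in
u, up to (ρu/v)²ε²/2, which is controlled by u² ≤ 2a² + 2ε² on the interval. The remaining average
yields ρab/v and the b²/2 term. -/
lemma integral_prod_cubeTest_le {v v' : ℝ≥0} (hv : v ≠ 0) (hv'0 : v' ≠ 0) {ρ : ℝ}
    (hρ : ρ ^ 2 < 1) (hv' : (v' : ℝ) = (1 - ρ ^ 2) * v) {ε : ℝ} (hε : 0 < ε) (a b : ℝ) :
    ∫ z : ℝ × ℝ, cubeTest v ε a z.1 * cubeTest v ε b (ρ * z.1 + z.2)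
        ∂((gaussianReal 0 v).prod (gaussianReal 0 v')) ≤
      (Real.sqrt (1 - ρ ^ 2))⁻¹ * Real.exp (ρ * (a * b) / v +
        (ρ * ε / v) ^ 2 * (a ^ 2 + b ^ 2 / 2 + ε ^ 2)) := by
  have hv0 : (0 : ℝ) < v := by positivity
  set R := (Real.sqrt (1 - ρ ^ 2))⁻¹ with hR
  have hR0 : 0 ≤ R := by positivity
  have hint : Integrable (fun z : ℝ × ℝ => cubeTest v ε a z.1 * cubeTest v ε b (ρ * z.1 + z.2))
      ((gaussianReal 0 v).prod (gaussianReal 0 v')) := by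
    refine Integrable.of_bound (C := Real.sqrt (2 * Real.pi * v) / (2 * ε) *
      Real.exp ((a ^ 2 + ε ^ 2) / v) * (Real.sqrt (2 * Real.pi * v) / (2 * ε) *
      Real.exp ((b ^ 2 + ε ^ 2) / v))) (Measurable.aestronglyMeasurable (by fun_prop))
      (ae_of_all _ fun z => ?_)
    rw [Real.norm_of_nonneg (mul_nonneg (cubeTest_nonneg hε _ _) (cubeTest_nonneg hε _ _))]
    exact mul_le_mul (cubeTest_le hv hε _ _) (cubeTest_le hv hε _ _) (cubeTest_nonneg hε _ _)
      (by positivity)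
  rw [integral_prod _ hint]
  simp_rw [integral_const_mul]
  rw [integral_gaussianReal_eq_integral_smul hv]
  have h2 : ∀ u, gaussianPDFReal 0 v u • (cubeTest v ε a u *
      ∫ w, cubeTest v ε b (ρ * u + w) ∂(gaussianReal 0 v')) ≤
      (Set.Icc (-a - ε) (-a + ε)).indicator
        (fun t => R * Real.exp ((ρ * ε / v) ^ 2 * (a ^ 2 + ε ^ 2)) *
          ((2 * ε)⁻¹ * Real.exp (-(ρ * b / v) * t))) u := by
    intro u
    rw [smul_eq_mul, ← mul_assoc, pdf_mul_cubeTest hv]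
    by_cases h : u ∈ Set.Icc (-a - ε) (-a + ε)
    · rw [Set.indicator_of_mem h, Set.indicator_of_mem h]
      refine (mul_le_mul_of_nonneg_left (integral_cubeTest_add_le hv hv'0 hρ hv' hε b u)
        (by positivity)).trans ?_
      rw [← hR, mul_left_comm, mul_assoc, mul_left_comm (Real.exp _), ← Real.exp_add]
      refine mul_le_mul_of_nonneg_left (mul_le_mul_of_nonneg_left (Real.exp_le_exp.2 ?_)
        (by positivity)) hR0
      have e : (ρ * u / v) ^ 2 * ε ^ 2 / 2 = (ρ * ε / v) ^ 2 * (u ^ 2 / 2) := by ring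
      rw [e]
      have := mul_le_mul_of_nonneg_left (sq_le_of_mem_Icc h) (sq_nonneg (ρ * ε / v))
      have e2 : -(ρ * u / v) * b = -(ρ * b / v) * u := by ring
      linarith
    · rw [Set.indicator_of_notMem h, Set.indicator_of_notMem h, zero_mul]
  have hi : Integrable ((Set.Icc (-a - ε) (-a + ε)).indicator
        (fun t => R * Real.exp ((ρ * ε / v) ^ 2 * (a ^ 2 + ε ^ 2)) *
          ((2 * ε)⁻¹ * Real.exp (-(ρ * b / v) * t)))) :=
    (ContinuousOn.integrableOn_compact isCompact_Icc (by fun_prop)).integrable_indicator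
      measurableSet_Icc
  refine (integral_mono_of_nonneg (ae_of_all _ fun u => mul_nonneg (gaussianPDFReal_nonneg _ _ _)
    (mul_nonneg (cubeTest_nonneg hε a u) (integral_nonneg fun w => cubeTest_nonneg hε b _)))
    hi (ae_of_all _ h2)).trans ?_
  rw [integral_indicator measurableSet_Icc, integral_const_mul]
  refine (mul_le_mul_of_nonneg_left (setIntegral_exp_mul_le hε a _) (by positivity)).trans
    (le_of_eq ?_)
  rw [mul_assoc, ← Real.exp_add]
  congr 2
  ring

end OneDim

/-! ### Gaussian vectors tested against two sign vectors -/

section Row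
open NNReal
variable {n : ℕ} (s : ℝ≥0)

lemma hasGaussianLaw_pi_gaussianReal :
    HasGaussianLaw (fun r : Fin n → ℝ => r) (Measure.pi fun _ : Fin n => gaussianReal 0 s) := by
  have hind : iIndepFun (fun (i : Fin n) (r : Fin n → ℝ) => r i)
      (Measure.pi fun _ : Fin n => gaussianReal 0 s) :=
    iIndepFun_pi (X := fun _ => id) fun _ => aemeasurable_id
  refine hind.hasGaussianLaw fun i => ⟨?_⟩
  rw [(measurePreserving_eval (fun _ : Fin n => gaussianReal 0 s) i).map_eq]
  infer_instance

lemma hasGaussianLaw_dotProduct_pair (x z : Fin n → ℝ) :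
    HasGaussianLaw (fun r : Fin n → ℝ => (r ⬝ᵥ x, r ⬝ᵥ z))
      (Measure.pi fun _ : Fin n => gaussianReal 0 s) := by
  let L : (Fin n → ℝ) →L[ℝ] ℝ × ℝ := LinearMap.toContinuousLinearMap
    { toFun := fun r => (r ⬝ᵥ x, r ⬝ᵥ z)
      map_add' := fun r r' => by simp [add_dotProduct]
      map_smul' := fun c r => by simp [smul_dotProduct] }
  exact (hasGaussianLaw_pi_gaussianReal s).map_fun L

lemma memLp_eval_pi_gaussianReal (i : Fin n) :
    MemLp (fun r : Fin n → ℝ => r i) 2 (Measure.pi fun _ : Fin n => gaussianReal 0 s) :=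
  ((hasGaussianLaw_pi_gaussianReal s).eval i).memLp_two

lemma integral_dotProduct_pi_gaussianReal (x : Fin n → ℝ) :
    ∫ r, r ⬝ᵥ x ∂(Measure.pi fun _ : Fin n => gaussianReal 0 s) = 0 := by
  simp only [dotProduct]
  rw [integral_finsetSum _ fun i _ =>
    ((memLp_eval_pi_gaussianReal s i).integrable one_le_two).mul_const _]
  refine Finset.sum_eq_zero fun i _ => ?_
  rw [integral_mul_const]
  have hm := (measurePreserving_eval (fun _ : Fin n => gaussianReal 0 s) i).map_eq
  have h2 := integral_map (μ := Measure.pi fun _ : Fin n => gaussianReal 0 s)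
    (measurable_pi_apply i).aemeasurable (f := fun t : ℝ => t) (by fun_prop)
  change Measure.map (fun r : Fin n → ℝ => r i) _ = _ at hm
  rw [hm] at h2
  rw [← h2, integral_id_gaussianReal, zero_mul]

lemma covariance_dotProduct_pi_gaussianReal (x z : Fin n → ℝ) :
    cov[fun r : Fin n → ℝ => r ⬝ᵥ x, fun r => r ⬝ᵥ z;
      Measure.pi fun _ : Fin n => gaussianReal 0 s] = s * (x ⬝ᵥ z) := by
  simp only [dotProduct]
  have hm : ∀ (y : Fin n → ℝ) (i : Fin n), MemLp (fun r : Fin n → ℝ => r i * y i) 2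
      (Measure.pi fun _ : Fin n => gaussianReal 0 s) := fun y i =>
    (memLp_eval_pi_gaussianReal s i).mul_const _
  rw [covariance_fun_sum_fun_sum (hm x) (hm z), Finset.mul_sum]
  refine Finset.sum_congr rfl fun i _ => ?_
  rw [Finset.sum_eq_single i]
  · rw [covariance_mul_const_left, covariance_mul_const_right, covariance_self
      (measurable_pi_apply i).aemeasurable]
    have h := (measurePreserving_eval (fun _ : Fin n => gaussianReal 0 s) i).map_eq
    change Measure.map (fun r : Fin n → ℝ => r i) _ = _ at h
    have h2 : Var[fun r : Fin n → ℝ => r i; Measure.pi fun _ : Fin n => gaussianReal 0 s] = s := by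
      have := variance_id_gaussianReal (μ := 0) (v := s)
      rw [← h, variance_map aemeasurable_id (measurable_pi_apply i).aemeasurable] at this
      exact this
    rw [h2]; ring
  · intro j _ hj
    rw [covariance_mul_const_left, covariance_mul_const_right]
    have hind : iIndepFun (fun (i : Fin n) (r : Fin n → ℝ) => r i)
        (Measure.pi fun _ : Fin n => gaussianReal 0 s) :=
      iIndepFun_pi (X := fun _ => id) fun _ => aemeasurable_id
    rw [(hind.indepFun hj.symm).covariance_eq_zero (memLp_eval_pi_gaussianReal s i)
      (memLp_eval_pi_gaussianReal s j)]
    ring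
  · simp

lemma map_dotProduct_pi_gaussianReal (x : Fin n → ℝ) {v : ℝ≥0} (hv : (v : ℝ) = s * (x ⬝ᵥ x)) :
    (Measure.pi fun _ : Fin n => gaussianReal 0 s).map (fun r => r ⬝ᵥ x) = gaussianReal 0 v := by
  have h := (hasGaussianLaw_dotProduct_pair s x x).fst.map_eq_gaussianReal
  rw [integral_dotProduct_pi_gaussianReal, ← covariance_self
    (hasGaussianLaw_dotProduct_pair s x x).fst.aemeasurable,
    covariance_dotProduct_pi_gaussianReal, ← hv, Real.toNNReal_coe] at h
  exact h

lemma map_dotProduct_pair_pi_gaussianReal (x z : Fin n → ℝ) (h0 : x ⬝ᵥ z = 0) {v v' : ℝ≥0}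
    (hv : (v : ℝ) = s * (x ⬝ᵥ x)) (hv' : (v' : ℝ) = s * (z ⬝ᵥ z)) :
    (Measure.pi fun _ : Fin n => gaussianReal 0 s).map (fun r => (r ⬝ᵥ x, r ⬝ᵥ z)) =
      (gaussianReal 0 v).prod (gaussianReal 0 v') := by
  have hG := hasGaussianLaw_dotProduct_pair s x z
  have hind := hG.indepFun_of_covariance_eq_zero (by
    rw [covariance_dotProduct_pi_gaussianReal, h0, mul_zero])
  rw [(indepFun_iff_map_prod_eq_prod_map_map hG.fst.aemeasurable hG.snd.aemeasurable).1 hind,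
    map_dotProduct_pi_gaussianReal s x hv, map_dotProduct_pi_gaussianReal s z hv']

@[fun_prop]
lemma measurable_dotProduct_right (x : Fin n → ℝ) : Measurable fun r : Fin n → ℝ => r ⬝ᵥ x := by
  unfold dotProduct; fun_prop

lemma integral_cubeTest_dotProduct (x : Fin n → ℝ) {v : ℝ≥0} (hv : (v : ℝ) = s * (x ⬝ᵥ x))
    (hv0 : v ≠ 0) {ε : ℝ} (hε : 0 < ε) (a : ℝ) :
    ∫ r, cubeTest v ε a (r ⬝ᵥ x) ∂(Measure.pi fun _ : Fin n => gaussianReal 0 s) = 1 := by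
  rw [← integral_cubeTest hv0 hε a, ← map_dotProduct_pi_gaussianReal s x hv,
    integral_map (by fun_prop) (Measurable.aestronglyMeasurable (by fun_prop))]

/-- Decompose y = ρx + z with z ⟂ x; then r·x and r·z are independent Gaussians of variances v and
(1 - ρ²)v. -/
lemma integral_cubeTest_mul_cubeTest_dotProduct_le (x y : Fin n → ℝ) {N ρ : ℝ}
    (hx : x ⬝ᵥ x = N) (hy : y ⬝ᵥ y = N) (hxy : x ⬝ᵥ y = ρ * N) (hρ : ρ ^ 2 < 1)
    {v : ℝ≥0} (hv : (v : ℝ) = s * N) (hv0 : v ≠ 0) {ε : ℝ} (hε : 0 < ε) (a b : ℝ) :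
    ∫ r, cubeTest v ε a (r ⬝ᵥ x) * cubeTest v ε b (r ⬝ᵥ y)
        ∂(Measure.pi fun _ : Fin n => gaussianReal 0 s) ≤
      (Real.sqrt (1 - ρ ^ 2))⁻¹ * Real.exp (ρ * (a * b) / v +
        (ρ * ε / v) ^ 2 * (a ^ 2 + b ^ 2 / 2 + ε ^ 2)) := by
  have hvp : (0 : ℝ) < v := by positivity
  have hq : 0 < (1 - ρ ^ 2) * v := mul_pos (by linarith) hvp
  obtain ⟨v', hv'⟩ : ∃ v' : ℝ≥0, (v' : ℝ) = (1 - ρ ^ 2) * v := ⟨_, Real.coe_toNNReal _ hq.le⟩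
  have hv'0 : v' ≠ 0 := by
    rw [← NNReal.coe_ne_zero, hv']; exact hq.ne'
  set z := y - ρ • x with hz
  have hyx : y ⬝ᵥ x = ρ * N := by rw [dotProduct_comm, hxy]
  have hxz : x ⬝ᵥ z = 0 := by
    rw [hz, dotProduct_sub, dotProduct_smul, hxy, hx, smul_eq_mul, sub_self]
  have hzz : z ⬝ᵥ z = (1 - ρ ^ 2) * N := by
    rw [hz, sub_dotProduct, dotProduct_sub, dotProduct_sub, smul_dotProduct, smul_dotProduct,
      dotProduct_smul, dotProduct_smul, hx, hy, hxy, hyx]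
    simp only [smul_eq_mul]
    ring
  have hmap := map_dotProduct_pair_pi_gaussianReal s x z hxz (v := v) (v' := v')
    (by rw [hx, hv]) (by rw [hzz, hv', hv]; ring)
  have h := integral_prod_cubeTest_le hv0 hv'0 hρ hv' hε a b
  rw [← hmap, integral_map (by fun_prop) (Measurable.aestronglyMeasurable (by fun_prop))] at h
  have e : ∀ r : Fin n → ℝ, ρ * (r ⬝ᵥ x) + r ⬝ᵥ z = r ⬝ᵥ y := by
    intro r; rw [hz, dotProduct_sub, dotProduct_smul, smul_eq_mul]; ring
  simpa only [e] using h

end Row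

/-! ### The product test function of a Gaussian matrix -/

section MatrixTest
open NNReal
variable {d n : ℕ}

instance isProbabilityMeasure_gaussianMatrixLaw (d n : ℕ) (σ : ℝ) :
    IsProbabilityMeasure (gaussianMatrixLaw d n σ) := by
  unfold gaussianMatrixLaw; infer_instance

/-- The product over the rows of `R` of the one-dimensional test functions. -/
noncomputable def matrixTest (v : ℝ≥0) (ε : ℝ) (a : Fin d → ℝ) (x : Fin n → ℝ)
    (R : Fin d → Fin n → ℝ) : ℝ :=
  ∏ i, cubeTest v ε (a i) (R i ⬝ᵥ x)

lemma matrixTest_nonneg {v : ℝ≥0} {ε : ℝ} (hε : 0 < ε) (a : Fin d → ℝ) (x : Fin n → ℝ)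
    (R : Fin d → Fin n → ℝ) : 0 ≤ matrixTest v ε a x R :=
  Finset.prod_nonneg fun _ _ => cubeTest_nonneg hε _ _

@[fun_prop]
lemma measurable_matrixTest (v : ℝ≥0) (ε : ℝ) (a : Fin d → ℝ) (x : Fin n → ℝ) :
    Measurable (matrixTest v ε a x) := by
  unfold matrixTest
  refine Finset.measurable_prod _ fun i _ => ?_
  exact (measurable_cubeTest v ε (a i)).comp
    ((measurable_dotProduct_right x).comp (measurable_pi_apply i))

lemma matrixTest_le {v : ℝ≥0} (hv : v ≠ 0) {ε : ℝ} (hε : 0 < ε) (a : Fin d → ℝ)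
    (x : Fin n → ℝ) (R : Fin d → Fin n → ℝ) :
    matrixTest v ε a x R ≤ (Real.sqrt (2 * Real.pi * v) / (2 * ε)) ^ d *
      Real.exp ((a ⬝ᵥ a + d * ε ^ 2) / v) := by
  refine (Finset.prod_le_prod (fun i _ => cubeTest_nonneg hε _ _)
    fun i _ => cubeTest_le hv hε _ _).trans (le_of_eq ?_)
  rw [Finset.prod_mul_distrib, ← Real.exp_sum, ← Finset.sum_div, Finset.sum_add_distrib]
  simp [dotProduct, sq, div_pow]

lemma integral_matrixTest {σ : ℝ} {x : Fin n → ℝ} {v : ℝ≥0}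
    (hv : (v : ℝ) = (σ ^ 2 / d).toNNReal * (x ⬝ᵥ x)) (hv0 : v ≠ 0) {ε : ℝ} (hε : 0 < ε)
    (a : Fin d → ℝ) : ∫ R, matrixTest v ε a x R ∂(gaussianMatrixLaw d n σ) = 1 := by
  unfold matrixTest gaussianMatrixLaw
  rw [integral_fintype_prod_eq_prod (fun i (r : Fin n → ℝ) => cubeTest v ε (a i) (r ⬝ᵥ x))]
  exact Finset.prod_eq_one fun i _ => integral_cubeTest_dotProduct _ x hv hv0 hε (a i)

lemma integral_matrixTest_mul_le {σ : ℝ} {x y : Fin n → ℝ} {N ρ : ℝ}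
    (hx : x ⬝ᵥ x = N) (hy : y ⬝ᵥ y = N) (hxy : x ⬝ᵥ y = ρ * N) (hρ : ρ ^ 2 < 1)
    {v : ℝ≥0} (hv : (v : ℝ) = (σ ^ 2 / d).toNNReal * N) (hv0 : v ≠ 0) {ε : ℝ} (hε : 0 < ε)
    (a b : Fin d → ℝ) :
    ∫ R, matrixTest v ε a x R * matrixTest v ε b y R ∂(gaussianMatrixLaw d n σ) ≤
      (Real.sqrt (1 - ρ ^ 2))⁻¹ ^ d * Real.exp (ρ * (a ⬝ᵥ b) / v +
        (ρ * ε / v) ^ 2 * (a ⬝ᵥ a + b ⬝ᵥ b / 2 + d * ε ^ 2)) := by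
  unfold matrixTest gaussianMatrixLaw
  simp_rw [← Finset.prod_mul_distrib]
  rw [integral_fintype_prod_eq_prod
    (fun i (r : Fin n → ℝ) => cubeTest v ε (a i) (r ⬝ᵥ x) * cubeTest v ε (b i) (r ⬝ᵥ y))]
  refine (Finset.prod_le_prod (fun i _ => integral_nonneg fun r =>
    mul_nonneg (cubeTest_nonneg hε _ _) (cubeTest_nonneg hε _ _)) fun i _ =>
    integral_cubeTest_mul_cubeTest_dotProduct_le _ x y hx hy hxy hρ hv hv0 hε (a i) (b i)).trans
    (le_of_eq ?_)
  rw [Finset.prod_mul_distrib, ← Real.exp_sum, Finset.sum_add_distrib, ← Finset.sum_div,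
    ← Finset.mul_sum, ← Finset.mul_sum, Finset.sum_add_distrib, Finset.sum_add_distrib,
    ← Finset.sum_div]
  simp [dotProduct, sq]

lemma integrable_matrixTest {v : ℝ≥0} (hv : v ≠ 0) {ε : ℝ} (hε : 0 < ε) (σ : ℝ) (a : Fin d → ℝ)
    (x : Fin n → ℝ) : Integrable (matrixTest v ε a x) (gaussianMatrixLaw d n σ) :=
  Integrable.of_bound (measurable_matrixTest v ε a x).aestronglyMeasurable _
    (ae_of_all _ fun R => by
      rw [Real.norm_of_nonneg (matrixTest_nonneg hε a x R)]
      exact matrixTest_le hv hε a x R)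

lemma integrable_matrixTest_mul {v : ℝ≥0} (hv : v ≠ 0) {ε : ℝ} (hε : 0 < ε) (σ : ℝ)
    (a b : Fin d → ℝ) (x y : Fin n → ℝ) :
    Integrable (fun R => matrixTest v ε a x R * matrixTest v ε b y R)
      (gaussianMatrixLaw d n σ) :=
  (integrable_matrixTest hv hε σ b y).bdd_mul
    (measurable_matrixTest v ε a x).aestronglyMeasurable
    (ae_of_all _ fun R => by
      rw [Real.norm_of_nonneg (matrixTest_nonneg hε a x R)]
      exact matrixTest_le hv hε a x R)

/-- For strongly correlated x and y: one factor is replaced by its supremum, and the other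
integrates to 1. -/
lemma integral_matrixTest_mul_le_of_bound {σ : ℝ} {x y : Fin n → ℝ} {v : ℝ≥0}
    (hv : (v : ℝ) = (σ ^ 2 / d).toNNReal * (x ⬝ᵥ x)) (hv0 : v ≠ 0) {ε : ℝ} (hε : 0 < ε)
    (a b : Fin d → ℝ) :
    ∫ R, matrixTest v ε a x R * matrixTest v ε b y R ∂(gaussianMatrixLaw d n σ) ≤
      (Real.sqrt (2 * Real.pi * v) / (2 * ε)) ^ d * Real.exp ((b ⬝ᵥ b + d * ε ^ 2) / v) := by
  calc _ ≤ ∫ R, matrixTest v ε a x R * ((Real.sqrt (2 * Real.pi * v) / (2 * ε)) ^ d *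
        Real.exp ((b ⬝ᵥ b + d * ε ^ 2) / v)) ∂(gaussianMatrixLaw d n σ) :=
        integral_mono (integrable_matrixTest_mul hv0 hε σ a b x y)
          ((integrable_matrixTest hv0 hε σ a x).mul_const _) fun R =>
          mul_le_mul_of_nonneg_left (matrixTest_le hv0 hε b y R) (matrixTest_nonneg hε a x R)
    _ = _ := by rw [integral_mul_const, integral_matrixTest hv hv0 hε a, one_mul]

lemma norm_mulVec_le_of_matrixTest_ne_zero {M : Matrix (Fin d) (Fin n) ℝ} {v : ℝ≥0} {ε : ℝ}
    (hε : 0 < ε) {x : Fin n → ℝ} {R : Fin d → Fin n → ℝ}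
    (h : matrixTest v ε (M *ᵥ x) x R ≠ 0) : ‖(M + Matrix.of R) *ᵥ x‖ ≤ ε := by
  rw [pi_norm_le_iff_of_nonneg hε.le]
  intro i
  rw [Matrix.add_mulVec, Pi.add_apply, Real.norm_eq_abs]
  exact abs_add_le_of_cubeTest_ne_zero (Finset.prod_ne_zero_iff.1 h i (Finset.mem_univ i))

end MatrixTest

/-! ### Second moment -/

/-- Pointwise, 2z - z² is at most 1 and vanishes at z = 0. -/
lemma two_mul_integral_sub_le_measureReal {Ω : Type*} [MeasurableSpace Ω] {P : Measure Ω}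
    [IsProbabilityMeasure P] {Z : Ω → ℝ} (hZm : Measurable Z) (hZ : ∀ ω, 0 ≤ Z ω)
    (hi : Integrable Z P) (hi2 : Integrable (fun ω => Z ω ^ 2) P) {S : Set Ω}
    (hS : ∀ ω, 0 < Z ω → ω ∈ S) : 2 * ∫ ω, Z ω ∂P - ∫ ω, Z ω ^ 2 ∂P ≤ P.real S := by
  have hmeas : MeasurableSet {ω | 0 < Z ω} := measurableSet_lt measurable_const hZm
  calc 2 * ∫ ω, Z ω ∂P - ∫ ω, Z ω ^ 2 ∂P = ∫ ω, (2 * Z ω - Z ω ^ 2) ∂P := by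
        rw [integral_sub (hi.const_mul 2) hi2, integral_const_mul]
    _ ≤ ∫ ω, {ω | 0 < Z ω}.indicator 1 ω ∂P := by
        refine integral_mono ((hi.const_mul 2).sub hi2)
          ((integrable_const (1 : ℝ)).indicator hmeas) fun ω => ?_
        by_cases h : 0 < Z ω
        · rw [Set.indicator_of_mem (show ω ∈ {ω | 0 < Z ω} from h), Pi.one_apply]
          nlinarith [sq_nonneg (Z ω - 1)]
        · rw [Set.indicator_of_notMem (show ω ∉ {ω | 0 < Z ω} from h),
            le_antisymm (not_lt.1 h) (hZ ω)]
          norm_num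
    _ = P.real {ω | 0 < Z ω} := integral_indicator_one hmeas
    _ ≤ P.real S := measureReal_mono hS

lemma sum_filter_lt_le_one_div {α : Type*} {S : Finset α} {w f : α → ℝ}
    (hw : ∀ x ∈ S, 0 ≤ w x) (hf : ∀ x ∈ S, 0 ≤ f x) {c m : ℝ} (hc : 0 < c)
    (hm : ∑ x ∈ S, w x * f x = m) : ∑ x ∈ S with c * m < f x, w x ≤ 1 / c := by
  have hm0 : 0 ≤ m := hm ▸ Finset.sum_nonneg fun x hx => mul_nonneg (hw x hx) (hf x hx)
  rcases hm0.eq_or_lt with h | h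
  -- With mean zero the threshold c·m is 0, and every x with f x > 0 has weight 0.
  · rw [← h] at hm ⊢
    rw [Finset.sum_eq_zero]
    · positivity
    · intro x hx
      rw [Finset.mem_filter, mul_zero] at hx
      have := (Finset.sum_eq_zero_iff_of_nonneg fun x hx => mul_nonneg (hw x hx) (hf x hx)).1 hm
        x hx.1
      exact (mul_eq_zero.1 this).resolve_right hx.2.ne'
  · have h1 : (c * m) * ∑ x ∈ S with c * m < f x, w x ≤ m := by
      rw [Finset.mul_sum]
      calc _ ≤ ∑ x ∈ S with c * m < f x, w x * f x := by
            refine Finset.sum_le_sum fun x hx => ?_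
            rw [Finset.mem_filter] at hx
            rw [mul_comm]
            exact mul_le_mul_of_nonneg_left hx.2.le (hw x hx.1)
        _ ≤ ∑ x ∈ S, w x * f x := Finset.sum_le_sum_of_subset_of_nonneg (Finset.filter_subset _ _)
            fun x hx _ => mul_nonneg (hw x hx) (hf x hx)
        _ = m := hm
    rw [le_div_iff₀ hc]
    refine le_of_mul_le_mul_right ?_ h
    linarith

/-! ### Numerical estimates -/

lemma inv_sqrt_one_sub_le {q : ℝ} (h0 : 0 ≤ q) (h : q ≤ 1 / 4) :
    (Real.sqrt (1 - q))⁻¹ ≤ Real.exp q := by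
  have h1 : (1 - q)⁻¹ ≤ Real.exp (2 * q) := by
    rw [inv_le_iff_one_le_mul₀ (by linarith)]
    have := Real.add_one_le_exp (2 * q)
    nlinarith
  rw [← Real.sqrt_inv]
  refine (Real.sqrt_le_sqrt h1).trans (le_of_eq ?_)
  rw [two_mul, Real.exp_add, Real.sqrt_mul_self (Real.exp_pos _).le]

lemma exp_half_add_le (p q : ℝ) : Real.exp ((p + q) / 2) ≤ (Real.exp p + Real.exp q) / 2 := by
  have e1 : Real.exp p = Real.exp (p / 2) ^ 2 := by rw [← Real.exp_nat_mul]; congr 1; push_cast; ring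
  have e2 : Real.exp q = Real.exp (q / 2) ^ 2 := by rw [← Real.exp_nat_mul]; congr 1; push_cast; ring
  rw [add_div, Real.exp_add, e1, e2]
  nlinarith [sq_nonneg (Real.exp (p / 2) - Real.exp (q / 2))]

/-- Here c stands for ⟨Mx,My⟩ and A, B for ‖Mx‖², ‖My‖². The multiples of dρ² are 1 from the
determinant, 1 from AM-GM on ρc/v and 5/2 from the width of the cube, in total below 5. The outer
factor 1/2 prepares `exp_half_add_le`, which separates the two squares. -/
lemma overlap_exponent_le {d L v ε ρ A B c : ℝ} (hd : 0 < d) (hv : 0 < v)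
    (h1 : (ε / v) ^ 2 * L ≤ 1) (h2 : (ε ^ 2 / v) ^ 2 ≤ 1) (hA : A ≤ d * L) (hB : B ≤ d * L) :
    d * ρ ^ 2 + (ρ * c / v + (ρ * ε / v) ^ 2 * (A + B / 2 + d * ε ^ 2)) ≤
      (10 * d * ρ ^ 2 + c ^ 2 / (2 * d * v ^ 2)) / 2 := by
  have e3 : (ρ * ε / v) ^ 2 * (A + B / 2 + d * ε ^ 2) ≤ ρ ^ 2 * (3 / 2 * d + d) := by
    have : (ρ * ε / v) ^ 2 * (A + B / 2 + d * ε ^ 2)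
        = ρ ^ 2 * ((ε / v) ^ 2 * (A + B / 2) + d * (ε ^ 2 / v) ^ 2) := by
      field_simp
    rw [this]
    have i1 : (ε / v) ^ 2 * (A + B / 2) ≤ 3 / 2 * d := by
      have := mul_le_mul_of_nonneg_left (show A + B / 2 ≤ 3 / 2 * d * L by linarith)
        (sq_nonneg (ε / v))
      nlinarith
    have i2 : d * (ε ^ 2 / v) ^ 2 ≤ d := mul_le_of_le_one_right hd.le h2
    exact mul_le_mul_of_nonneg_left (add_le_add i1 i2) (sq_nonneg ρ)
  have e4 : ρ * c / v ≤ d * ρ ^ 2 + c ^ 2 / (4 * d * v ^ 2) := by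
    have : d * ρ ^ 2 + c ^ 2 / (4 * d * v ^ 2) - ρ * c / v
        = (2 * d * v * ρ - c) ^ 2 / (4 * d * v ^ 2) := by
      field_simp
      ring
    have : 0 ≤ (2 * d * v * ρ - c) ^ 2 / (4 * d * v ^ 2) := by positivity
    linarith
  have e5 : c ^ 2 / (2 * d * v ^ 2) / 2 = c ^ 2 / (4 * d * v ^ 2) := by
    field_simp; ring
  have : 0 ≤ d * ρ ^ 2 := by positivity
  linarith

lemma one_div_one_sub_le {q L : ℝ} (hL : 128 ≤ L) (hq : q ≤ 40 / L) :
    1 / (1 - q) ≤ 1 + 80 / L := by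
  have hL0 : 0 < L := by linarith
  have h40 : 40 / L ≤ 1 / 2 := by rw [div_le_div_iff₀ hL0 two_pos]; linarith
  have e : 80 / L = 2 * (40 / L) := by ring
  have p : 0 ≤ 40 / L := by positivity
  rw [e, div_le_iff₀ (by linarith)]
  nlinarith

/-- The relations between the parameters that the second moment computation uses. -/
structure NoiseParams (d n : ℕ) (L κ σ ε v : ℝ) : Prop where
  d_pos : 0 < d
  n_eq : (n : ℝ) = κ * d * L
  one_le_κ : 1 ≤ κ
  one_le_σ : 1 ≤ σ
  le_L : 128 ≤ L
  L_le : L ≤ d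
  v_eq : v = σ ^ 2 * κ * L
  ε_eq : ε = σ * Real.sqrt L * Real.exp (-(κ * L / 32))

namespace NoiseParams
variable {d n : ℕ} {L κ σ ε v : ℝ} (h : NoiseParams d n L κ σ ε v)
include h

lemma L_pos : 0 < L := by linarith [h.le_L]

lemma κ_pos : 0 < κ := by linarith [h.one_le_κ]

lemma σ_pos : 0 < σ := by linarith [h.one_le_σ]

lemma ε_pos : 0 < ε := by
  have := h.L_pos; have := h.σ_pos
  rw [h.ε_eq]; positivity

lemma L_le_v : L ≤ v := by
  have h1 := one_le_pow₀ h.one_le_σ (n := 2)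
  have h2 := one_le_mul_of_one_le_of_one_le h1 h.one_le_κ
  rw [h.v_eq]
  exact le_mul_of_one_le_left h.L_pos.le h2

lemma v_pos : 0 < v := h.L_pos.trans_le h.L_le_v

lemma ε_sq_le : ε ^ 2 ≤ σ ^ 2 * L := by
  have : Real.exp (-(κ * L / 32)) ≤ 1 := by
    have := h.L_pos; have := h.κ_pos
    rw [Real.exp_le_one_iff, neg_nonpos]; positivity
  rw [h.ε_eq, mul_pow, mul_pow, Real.sq_sqrt h.L_pos.le]
  have h2 := pow_le_one₀ (n := 2) (Real.exp_pos _).le this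
  have := h.L_pos
  exact mul_le_of_le_one_right (by positivity) h2

lemma ε_sq_div_le : ε ^ 2 / v ≤ 1 := by
  rw [div_le_one h.v_pos, h.v_eq]
  refine h.ε_sq_le.trans ?_
  have := h.L_pos
  have : σ ^ 2 * L * 1 ≤ σ ^ 2 * L * κ := mul_le_mul_of_nonneg_left h.one_le_κ (by positivity)
  linarith

lemma ε_div_sq_mul_le : (ε / v) ^ 2 * L ≤ 1 := by
  have e : (ε / v) ^ 2 * L = (ε ^ 2 / v) * (L / v) := by ring
  have := h.v_pos
  have := h.L_pos
  rw [e]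
  exact mul_le_one₀ h.ε_sq_div_le (by positivity) ((div_le_one h.v_pos).2 h.L_le_v)

lemma sqrt_div_le : Real.sqrt (2 * Real.pi * v) / (2 * ε) ≤ Real.exp (κ + κ * L / 32) := by
  have hL := h.L_pos
  have hσ := h.σ_pos
  have hκ := h.κ_pos
  have e1 : Real.sqrt (2 * Real.pi * v) ≤ σ * Real.sqrt L * (2 * Real.exp κ) := by
    rw [Real.sqrt_le_left (by positivity), mul_pow, mul_pow, Real.sq_sqrt hL.le, mul_pow, h.v_eq,
      ← Real.exp_nat_mul]
    have h1 := Real.add_one_le_exp ((2 : ℕ) * κ)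
    push_cast at h1 ⊢
    have h2 : 2 * Real.pi * κ ≤ 2 ^ 2 * Real.exp (2 * κ) := by
      nlinarith [Real.pi_le_four, Real.pi_pos]
    calc 2 * Real.pi * (σ ^ 2 * κ * L) = σ ^ 2 * L * (2 * Real.pi * κ) := by ring
      _ ≤ _ := mul_le_mul_of_nonneg_left h2 (by positivity)
  rw [div_le_iff₀ (by have := h.ε_pos; positivity)]
  refine e1.trans (le_of_eq ?_)
  have e2 : Real.exp (κ + κ * L / 32) * Real.exp (-(κ * L / 32)) = Real.exp κ := by
    rw [← Real.exp_add]; congr 1; ring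
  rw [← e2, h.ε_eq]
  ring

lemma sqrt_div_pow_mul_exp_le {B : ℝ} (hB : B ≤ d * L) :
    (Real.sqrt (2 * Real.pi * v) / (2 * ε)) ^ d * Real.exp ((B + d * ε ^ 2) / v) ≤
      Real.exp (d * κ * (3 + L / 32)) := by
  have hε := h.ε_pos
  have hd : (0 : ℝ) < d := by exact_mod_cast h.d_pos
  have h1 := pow_le_pow_left₀ (by positivity) h.sqrt_div_le d
  rw [← Real.exp_nat_mul] at h1
  refine (mul_le_mul_of_nonneg_right h1 (Real.exp_pos _).le).trans ?_
  rw [← Real.exp_add]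
  refine Real.exp_le_exp.2 ?_
  have h2 : B / v ≤ d := by
    rw [div_le_iff₀ h.v_pos]
    exact hB.trans (mul_le_mul_of_nonneg_left h.L_le_v hd.le)
  have h3 : d * ε ^ 2 / v ≤ d := by
    rw [mul_div_assoc]; exact mul_le_of_le_one_right hd.le h.ε_sq_div_le
  have h4 : (d : ℝ) ≤ d * κ := le_mul_of_one_le_right hd.le h.one_le_κ
  rw [add_div]
  linarith

/-- Far overlaps are negligible: the exponent is dκ(3 - L/32) ≤ -dκ ≤ -L. The condition 128 ≤ L is
what makes 3 - L/32 ≤ -1. -/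
lemma two_mul_exp_mul_exp_le :
    2 * Real.exp (-((n / 2 : ℝ) ^ 2 / (4 * n))) * Real.exp (d * κ * (3 + L / 32)) ≤ 2 / L := by
  have hd : (0 : ℝ) < d := by exact_mod_cast h.d_pos
  have hL := h.L_pos
  have hκ := h.κ_pos
  have hn : (n : ℝ) ≠ 0 := by rw [h.n_eq]; positivity
  have e : (n / 2 : ℝ) ^ 2 / (4 * n) = κ * d * L / 16 := by
    rw [← h.n_eq]; field_simp; norm_num
  rw [e, mul_assoc, ← Real.exp_add, div_eq_mul_inv]
  refine mul_le_mul_of_nonneg_left ?_ zero_le_two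
  have h1 : -(κ * d * L / 16) + d * κ * (3 + L / 32) ≤ -L := by
    have h4 : (d : ℝ) ≤ d * κ := le_mul_of_one_le_right hd.le h.one_le_κ
    have h5 : d * κ * (4 - L / 32) ≤ 0 :=
      mul_nonpos_of_nonneg_of_nonpos (by positivity) (by linarith [h.le_L])
    have := h.L_le
    nlinarith
  refine (Real.exp_le_exp.2 h1).trans ?_
  rw [Real.exp_neg]
  exact inv_anti₀ hL (by linarith [Real.add_one_le_exp L])

end NoiseParams

/-! ### Truncated second moment of the reweighted count -/

section Main
open NNReal
variable {d n : ℕ} {L κ σ ε v : ℝ}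

/-- The sign vectors in the support of the truncated count. -/
noncomputable def truncatedSigns (M : Matrix (Fin d) (Fin n) ℝ) (C L : ℝ) :
    Finset (Fin n → ℝ) :=
  {x ∈ signVectors n | l2norm (M *ᵥ x) ^ 2 ≤
    C * ∑ z ∈ signVectors n, gswWeight M z * l2norm (M *ᵥ z) ^ 2 ∧ l2norm (M *ᵥ x) ^ 2 ≤ d * L}

/-- Two Markov bounds: 1/C for leaving B, and 8/L for ‖Mx‖² > dL, because the mean of ‖Mx‖² is at
most 8d. -/
lemma le_sum_truncatedSigns {M : Matrix (Fin d) (Fin n) ℝ}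
    (hM : ∀ j, l2norm (fun i => M i j) ≤ 1) {C : ℝ} (hC : 0 < C) (hd : 0 < d) (hL : 0 < L) :
    1 - 1 / C - 8 / L ≤ ∑ x ∈ truncatedSigns M C L, gswWeight M x := by
  set m := ∑ z ∈ signVectors n, gswWeight M z * l2norm (M *ᵥ z) ^ 2 with hm
  have hd' : (0 : ℝ) < d := by exact_mod_cast hd
  have h1 : ∑ x ∈ signVectors n with C * m < l2norm (M *ᵥ x) ^ 2, gswWeight M x ≤ 1 / C :=
    sum_filter_lt_le_one_div (fun x _ => gswWeight_nonneg M x) (fun x _ => sq_nonneg _) hC rfl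
  have h2 : ∑ x ∈ signVectors n with d * L < l2norm (M *ᵥ x) ^ 2, gswWeight M x ≤ 8 / L := by
    have h8 : m ≤ 8 * d := sum_gswWeight_mul_sq_le M hM
    have : (d * L) * ∑ x ∈ signVectors n with d * L < l2norm (M *ᵥ x) ^ 2, gswWeight M x ≤ m := by
      rw [Finset.mul_sum]
      refine (Finset.sum_le_sum fun x hx => ?_).trans (Finset.sum_le_sum_of_subset_of_nonneg
        (Finset.filter_subset _ _) fun x _ _ => mul_nonneg (gswWeight_nonneg M x) (sq_nonneg _))
      rw [mul_comm]
      exact mul_le_mul_of_nonneg_left (Finset.mem_filter.1 hx).2.le (gswWeight_nonneg M x)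
    rw [le_div_iff₀ hL]
    refine le_of_mul_le_mul_left ?_ hd'
    linarith
  have h3 : ∑ x ∈ signVectors n, gswWeight M x ≤ ∑ x ∈ truncatedSigns M C L, gswWeight M x +
      (∑ x ∈ signVectors n with C * m < l2norm (M *ᵥ x) ^ 2, gswWeight M x +
        ∑ x ∈ signVectors n with d * L < l2norm (M *ᵥ x) ^ 2, gswWeight M x) := by
    rw [truncatedSigns, ← hm, Finset.sum_filter, Finset.sum_filter, Finset.sum_filter,
      ← Finset.sum_add_distrib, ← Finset.sum_add_distrib]
    refine Finset.sum_le_sum fun x _ => ?_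
    have := gswWeight_nonneg M x
    by_cases a : l2norm (M *ᵥ x) ^ 2 ≤ C * m <;> by_cases b : l2norm (M *ᵥ x) ^ 2 ≤ d * L <;>
      simp [a, b, not_lt.2, not_le.1, this]
  rw [sum_gswWeight] at h3
  linarith

lemma NoiseParams.integral_matrixTest_mul_le (h : NoiseParams d n L κ σ ε v)
    {x y : Fin n → ℝ} (hx : x ∈ signVectors n) (hy : y ∈ signVectors n) {a b : Fin d → ℝ}
    (ha : a ⬝ᵥ a ≤ d * L) (hb : b ⬝ᵥ b ≤ d * L) :
    ∫ R, matrixTest v.toNNReal ε a x R * matrixTest v.toNNReal ε b y R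
        ∂(gaussianMatrixLaw d n σ) ≤
      (Real.exp (10 * d / n ^ 2 * (x ⬝ᵥ y) ^ 2) +
        Real.exp (1 / (2 * d * v ^ 2) * (a ⬝ᵥ b) ^ 2)) / 2 +
      if (n / 2 : ℝ) < |x ⬝ᵥ y| then Real.exp (d * κ * (3 + L / 32)) else 0 := by
  have hd : (0 : ℝ) < d := by exact_mod_cast h.d_pos
  have hL := h.L_pos
  have hκ := h.κ_pos
  have hv := h.v_pos
  have hn : (0 : ℝ) < n := by rw [h.n_eq]; positivity
  have hvc : (v.toNNReal : ℝ) = v := Real.coe_toNNReal v hv.le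
  have hv0 : v.toNNReal ≠ 0 := by simpa using hv
  have hxx := dotProduct_self_of_mem_signVectors hx
  have hyy := dotProduct_self_of_mem_signVectors hy
  have hvn : (v.toNNReal : ℝ) = (σ ^ 2 / d).toNNReal * (n : ℝ) := by
    rw [hvc, Real.coe_toNNReal _ (by positivity), h.v_eq, h.n_eq]
    field_simp
  split_ifs with hov
  -- Overlap above n/2: the correlation bound degenerates as ρ² → 1, so the supremum bound is used.
  · have := integral_matrixTest_mul_le_of_bound (hxx ▸ hvn) hv0 h.ε_pos a b (y := y) (x := x)
    rw [hvc] at this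
    have h2 := this.trans (h.sqrt_div_pow_mul_exp_le hb)
    have : 0 < (Real.exp (10 * d / n ^ 2 * (x ⬝ᵥ y) ^ 2) +
        Real.exp (1 / (2 * d * v ^ 2) * (a ⬝ᵥ b) ^ 2)) / 2 := by positivity
    linarith
  · rw [add_zero]
    set ρ := (x ⬝ᵥ y) / n with hρ
    have hρn : x ⬝ᵥ y = ρ * n := by rw [hρ]; field_simp
    have hρ1 : ρ ^ 2 ≤ 1 / 4 := by
      have : |ρ| ≤ 1 / 2 := by
        rw [hρ, abs_div, abs_of_pos hn, div_le_iff₀ hn]; linarith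
      rw [← sq_abs]
      nlinarith [abs_nonneg ρ]
    have h1 := _root_.integral_matrixTest_mul_le hxx hyy hρn (by linarith) hvn hv0 h.ε_pos a b
    rw [hvc] at h1
    have h2 := pow_le_pow_left₀ (by positivity) (inv_sqrt_one_sub_le (sq_nonneg ρ) hρ1) d
    rw [← Real.exp_nat_mul] at h2
    refine h1.trans ((mul_le_mul_of_nonneg_right h2 (Real.exp_pos _).le).trans ?_)
    rw [← Real.exp_add]
    have h5 : (ε ^ 2 / v) ^ 2 ≤ 1 := pow_le_one₀ (by positivity) h.ε_sq_div_le
    refine (Real.exp_le_exp.2 (overlap_exponent_le hd hv h.ε_div_sq_mul_le h5 ha hb)).trans ?_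
    refine (exp_half_add_le _ _).trans (le_of_eq ?_)
    congr 3
    · rw [hρ]; field_simp
    · ring

/-- For fixed y, both ⟨x,y⟩ and ⟨Mx,My⟩ are linear functionals of the walk's output, with V equal to
n and ‖My‖² ≤ dL respectively. The quantity 4λV is then 40/(κL) in the first case and at most 2/L in
the second. -/
lemma NoiseParams.sum_integral_le (h : NoiseParams d n L κ σ ε v) {M : Matrix (Fin d) (Fin n) ℝ}
    (hM : ∀ j, l2norm (fun i => M i j) ≤ 1) (C : ℝ) {y : Fin n → ℝ}
    (hy : y ∈ truncatedSigns M C L) :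
    ∑ x ∈ truncatedSigns M C L, gswWeight M x *
      ∫ R, matrixTest v.toNNReal ε (M *ᵥ x) x R * matrixTest v.toNNReal ε (M *ᵥ y) y R
        ∂(gaussianMatrixLaw d n σ) ≤ 1 + 82 / L := by
  have hd : (0 : ℝ) < d := by exact_mod_cast h.d_pos
  have hL := h.L_pos
  have hκ := h.κ_pos
  have hv := h.v_pos
  have hn : (0 : ℝ) < n := by rw [h.n_eq]; positivity
  obtain ⟨hyS, -, hyL⟩ := Finset.mem_filter.1 hy
  rw [l2norm_sq] at hyL
  have hyy := dotProduct_self_of_mem_signVectors hyS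
  set Q := Real.exp (d * κ * (3 + L / 32)) with hQ
  have hw := fun x (_ : x ∈ signVectors n) => gswWeight_nonneg M x
  have t1 : ∀ τ : ℝ, ∑ x ∈ signVectors n, gswWeight M x * Real.exp (τ * (x ⬝ᵥ y)) ≤
      Real.exp (τ ^ 2 * n) := fun τ => hyy ▸ sum_gswWeight_mul_exp_le M hM y τ
  have s1 : ∑ x ∈ signVectors n, gswWeight M x * Real.exp (10 * d / n ^ 2 * (x ⬝ᵥ y) ^ 2) ≤
      1 + 80 / L := by
    have hq : 4 * (10 * d / (n : ℝ) ^ 2) * n ≤ 40 / L := by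
      have e : 4 * (10 * d / (n : ℝ) ^ 2) * n = 40 / (κ * L) := by
        rw [h.n_eq]; field_simp; norm_num
      rw [e]
      exact div_le_div_of_nonneg_left (by norm_num) hL (le_mul_of_one_le_left hL.le h.one_le_κ)
    have h40 : 40 / L < 1 := by rw [div_lt_one hL]; linarith [h.le_L]
    exact (sum_mul_exp_mul_sq_le t1 hn.le (by positivity) (by linarith)).trans
      (one_div_one_sub_le h.le_L hq)
  have s2 : ∑ x ∈ signVectors n, gswWeight M x *
      Real.exp (1 / (2 * d * v ^ 2) * ((M *ᵥ x) ⬝ᵥ (M *ᵥ y)) ^ 2) ≤ 1 + 80 / L := by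
    have hq : 4 * (1 / (2 * d * v ^ 2)) * ((M *ᵥ y) ⬝ᵥ (M *ᵥ y)) ≤ 40 / L := by
      calc _ ≤ 4 * (1 / (2 * d * v ^ 2)) * (d * L) :=
            mul_le_mul_of_nonneg_left hyL (by positivity)
        _ = 2 * L / v ^ 2 := by field_simp; norm_num
        _ ≤ 2 * L / L ^ 2 := by
            have := h.L_le_v
            gcongr
        _ = 2 / L := by field_simp
        _ ≤ 40 / L := by gcongr; norm_num
    have h40 : 40 / L < 1 := by rw [div_lt_one hL]; linarith [h.le_L]
    refine (sum_mul_exp_mul_sq_le (sum_gswWeight_mul_exp_mulVec_le M hM (M *ᵥ y)) ?_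
      (by positivity) (by linarith)).trans (one_div_one_sub_le h.le_L hq)
    rw [← l2norm_sq]; positivity
  have s3 : ∑ x ∈ signVectors n, gswWeight M x *
      (if (n / 2 : ℝ) < |x ⬝ᵥ y| then Q else 0) ≤ 2 / L := by
    have := sum_filter_lt_abs_le (s := (n / 2 : ℝ)) hw t1 hn (by positivity)
    simp only [mul_ite, mul_zero]
    rw [← Finset.sum_filter, ← Finset.sum_mul]
    exact (mul_le_mul_of_nonneg_right this (Real.exp_pos _).le).trans h.two_mul_exp_mul_exp_le
  calc _ ≤ ∑ x ∈ truncatedSigns M C L, gswWeight M x *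
        ((Real.exp (10 * d / n ^ 2 * (x ⬝ᵥ y) ^ 2) +
          Real.exp (1 / (2 * d * v ^ 2) * ((M *ᵥ x) ⬝ᵥ (M *ᵥ y)) ^ 2)) / 2 +
        if (n / 2 : ℝ) < |x ⬝ᵥ y| then Q else 0) := by
        refine Finset.sum_le_sum fun x hx => mul_le_mul_of_nonneg_left ?_ (gswWeight_nonneg M x)
        obtain ⟨hxS, -, hxL⟩ := Finset.mem_filter.1 hx
        rw [l2norm_sq] at hxL
        exact h.integral_matrixTest_mul_le hxS hyS hxL hyL
    _ ≤ ∑ x ∈ signVectors n, gswWeight M x *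
        ((Real.exp (10 * d / n ^ 2 * (x ⬝ᵥ y) ^ 2) +
          Real.exp (1 / (2 * d * v ^ 2) * ((M *ᵥ x) ⬝ᵥ (M *ᵥ y)) ^ 2)) / 2 +
        if (n / 2 : ℝ) < |x ⬝ᵥ y| then Q else 0) := by
        refine Finset.sum_le_sum_of_subset_of_nonneg (Finset.filter_subset _ _) fun x _ _ => ?_
        have := gswWeight_nonneg M x
        have hQ0 : 0 ≤ if (n / 2 : ℝ) < |x ⬝ᵥ y| then Q else 0 := by
          split_ifs
          · exact (Real.exp_pos _).le
          · exact le_rfl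
        positivity
    _ = (∑ x ∈ signVectors n, gswWeight M x * Real.exp (10 * d / n ^ 2 * (x ⬝ᵥ y) ^ 2) +
        ∑ x ∈ signVectors n, gswWeight M x *
          Real.exp (1 / (2 * d * v ^ 2) * ((M *ᵥ x) ⬝ᵥ (M *ᵥ y)) ^ 2)) / 2 +
        ∑ x ∈ signVectors n, gswWeight M x * (if (n / 2 : ℝ) < |x ⬝ᵥ y| then Q else 0) := by
        rw [← Finset.sum_add_distrib, Finset.sum_div, ← Finset.sum_add_distrib]
        exact Finset.sum_congr rfl fun x _ => by ring
    _ ≤ (1 + 80 / L + (1 + 80 / L)) / 2 + 2 / L := by linarith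
    _ = 1 + 82 / L := by ring

/-- The tilt has a positive density, so it has the same null sets as the restricted walk law. -/
lemma reweightedLaw_pos (M : Matrix (Fin d) (Fin n) ℝ) (σ C : ℝ) {x : Fin n → ℝ}
    (hx : x ∈ goodSigns M C) (hw : 0 < gswWeight M x) {S : Set (Fin n → ℝ)} (hxS : x ∈ S) :
    0 < reweightedLaw M σ C S := by
  rw [pos_iff_ne_zero]
  intro h0
  have hac := absolutelyContinuous_tilted (μ := (gswLaw (augmented M)).restrict (goodSigns M C))
    (f := fun x => d * l2norm (M *ᵥ x) ^ 2 / (2 * σ ^ 2 * n))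
    (integrable_gswLawFrom (augmented M) n (by simp) _).restrict
  have h1 := measure_mono_null (Set.singleton_subset_iff.2 hxS) (hac h0)
  rw [Measure.restrict_apply (measurableSet_singleton x),
    Set.inter_eq_left.2 (Set.singleton_subset_iff.2 hx)] at h1
  rw [gswWeight, measureReal_def, h1] at hw
  simp at hw

lemma NoiseParams.le_measureReal (h : NoiseParams d n L κ σ ε v) {M : Matrix (Fin d) (Fin n) ℝ}
    (hM : ∀ j, l2norm (fun i => M i j) ≤ 1) {C : ℝ} (hC : 0 < C) :
    1 - (100 / L + 2 / C) ≤ (gaussianMatrixLaw d n σ).real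
      {R | 0 < reweightedLaw M σ C {y | ‖(M + Matrix.of R) *ᵥ y‖ ≤ ε}} := by
  have hd : (0 : ℝ) < d := by exact_mod_cast h.d_pos
  have hL := h.L_pos
  have hκ := h.κ_pos
  have hv := h.v_pos
  have hε := h.ε_pos
  have hvc : (v.toNNReal : ℝ) = v := Real.coe_toNNReal v hv.le
  have hv0 : v.toNNReal ≠ 0 := by simpa using hv
  have hvn : (v.toNNReal : ℝ) = (σ ^ 2 / d).toNNReal * (n : ℝ) := by
    rw [hvc, Real.coe_toNNReal _ (by positivity), h.v_eq, h.n_eq]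
    field_simp
  set T := truncatedSigns M C L with hT
  set F : (Fin n → ℝ) → (Fin d → Fin n → ℝ) → ℝ := fun x =>
    matrixTest v.toNNReal ε (M *ᵥ x) x with hF
  set Z : (Fin d → Fin n → ℝ) → ℝ := fun R => ∑ x ∈ T, gswWeight M x * F x R with hZ
  have hFi : ∀ x, Integrable (F x) (gaussianMatrixLaw d n σ) := fun x =>
    integrable_matrixTest hv0 hε σ _ x
  have hFFi : ∀ x y, Integrable (fun R => F x R * F y R) (gaussianMatrixLaw d n σ) := fun x y =>
    integrable_matrixTest_mul hv0 hε σ _ _ x y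
  have hZm : Measurable Z := by
    refine Finset.measurable_sum _ fun x _ => ?_
    exact (measurable_matrixTest _ _ _ _).const_mul _
  have hZ0 : ∀ R, 0 ≤ Z R := fun R => Finset.sum_nonneg fun x _ =>
    mul_nonneg (gswWeight_nonneg M x) (matrixTest_nonneg hε _ _ _)
  have hZi : Integrable Z (gaussianMatrixLaw d n σ) :=
    integrable_finsetSum _ fun x _ => (hFi x).const_mul _
  have hZ2 : ∀ R, Z R ^ 2 = ∑ y ∈ T, ∑ x ∈ T,
      gswWeight M y * (gswWeight M x * (F x R * F y R)) := by
    intro R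
    rw [hZ, sq, Finset.sum_mul_sum, Finset.sum_comm]
    exact Finset.sum_congr rfl fun y _ => Finset.sum_congr rfl fun x _ => by ring
  have hZ2i : Integrable (fun R => Z R ^ 2) (gaussianMatrixLaw d n σ) := by
    simp_rw [hZ2]
    exact integrable_finsetSum _ fun y _ => integrable_finsetSum _ fun x _ =>
      ((hFFi x y).const_mul _).const_mul _
  have hE : ∫ R, Z R ∂(gaussianMatrixLaw d n σ) = ∑ x ∈ T, gswWeight M x := by
    rw [hZ, integral_finsetSum _ fun x _ => (hFi x).const_mul _]
    refine Finset.sum_congr rfl fun x hx => ?_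
    rw [integral_const_mul, hF, integral_matrixTest
      (by rw [dotProduct_self_of_mem_signVectors (Finset.mem_filter.1 hx).1]; exact hvn) hv0 hε,
      mul_one]
  have hE2 : ∫ R, Z R ^ 2 ∂(gaussianMatrixLaw d n σ) ≤ 1 + 82 / L := by
    simp_rw [hZ2]
    rw [integral_finsetSum _ fun y _ => integrable_finsetSum _ fun x _ =>
      ((hFFi x y).const_mul _).const_mul _]
    calc _ ≤ ∑ y ∈ T, gswWeight M y * (1 + 82 / L) := by
          refine Finset.sum_le_sum fun y hy => ?_
          rw [integral_finsetSum _ fun x _ => ((hFFi x y).const_mul _).const_mul _]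
          simp_rw [integral_const_mul, ← Finset.mul_sum]
          exact mul_le_mul_of_nonneg_left (h.sum_integral_le hM C hy) (gswWeight_nonneg M y)
      _ ≤ ∑ y ∈ signVectors n, gswWeight M y * (1 + 82 / L) :=
          Finset.sum_le_sum_of_subset_of_nonneg (Finset.filter_subset _ _) fun y _ _ =>
            mul_nonneg (gswWeight_nonneg M y) (by positivity)
      _ = 1 + 82 / L := by rw [← Finset.sum_mul, sum_gswWeight, one_mul]
  have hpos : ∀ R, 0 < Z R →
      R ∈ {R | 0 < reweightedLaw M σ C {y | ‖(M + Matrix.of R) *ᵥ y‖ ≤ ε}} := by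
    intro R hR
    obtain ⟨x, hxT, hx⟩ := Finset.exists_ne_zero_of_sum_ne_zero hR.ne'
    obtain ⟨hxS, hxC, -⟩ := Finset.mem_filter.1 hxT
    refine reweightedLaw_pos M σ C (x := x) ⟨mem_signVectors.1 hxS, ?_⟩
      ((gswWeight_nonneg M x).lt_of_ne (left_ne_zero_of_mul hx).symm)
      (norm_mulVec_le_of_matrixTest_ne_zero hε (right_ne_zero_of_mul hx))
    rw [integral_gswLaw]
    exact hxC
  have key := two_mul_integral_sub_le_measureReal hZm hZ0 hZi hZ2i hpos
  have hw := le_sum_truncatedSigns hM hC h.d_pos hL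
  rw [hE] at key
  refine le_trans ?_ key
  -- The failure probability is 2(1/C + 8/L) + 82/L = 2/C + 98/L, rounded up.
  have e1 : 100 / L = 2 * (8 / L) + 82 / L + 2 / L := by ring
  have e2 : 2 / C = 2 * (1 / C) := by ring
  have : 0 ≤ 2 / L := by positivity
  linarith

end Main

/-- The failure probability of the theorem. -/
noncomputable def failureBound (C : ℕ → ℝ) (d : ℕ) : ℝ :=
  -- The value 1 makes the claim trivial for the remaining d, which are finitely many when C tends
  -- to infinity.
  if 128 ≤ Real.log d ∧ 0 < C d then 100 / Real.log d + 2 / C d else 1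

lemma tendsto_log_natCast : Tendsto (fun d : ℕ => Real.log d) atTop atTop :=
  Real.tendsto_log_atTop.comp tendsto_natCast_atTop_atTop

lemma failureBound_eventuallyEq {C : ℕ → ℝ} (hC : Tendsto C atTop atTop) :
    failureBound C =ᶠ[atTop] fun d => 100 / Real.log d + 2 / C d := by
  filter_upwards [tendsto_log_natCast.eventually_ge_atTop 128, hC.eventually_gt_atTop 0]
    with d h1 h2
  rw [failureBound, if_pos ⟨h1, h2⟩]

theorem mainTheorem3 (C : ℕ → ℝ) (hC : Tendsto C atTop atTop)
    (hC' : ∀ᶠ d : ℕ in atTop, C d ≤ Real.log d ^ 2) :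
    ∃ c : ℕ → ℝ, Tendsto c atTop (𝓝 0) ∧
      ((C = fun d : ℕ => Real.log d ^ 2) → c =Θ[atTop] fun d : ℕ => 1 / Real.log d) ∧
      ∀ (d n : ℕ) (κ σ ε : ℝ) (M : Matrix (Fin d) (Fin n) ℝ),
        1 ≤ κ → 1 ≤ σ → (n : ℝ) = κ * d * Real.log d →
        ε = σ * Real.sqrt (Real.log d) * (d : ℝ) ^ (-κ / 32) →
        (∀ j, l2norm (fun i => M i j) ≤ 1) →
        1 - c d ≤ (gaussianMatrixLaw d n σ).real
          {R | 0 < reweightedLaw M σ (C d) {y | ‖(M + Matrix.of R) *ᵥ y‖ ≤ ε}} := by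
  refine ⟨failureBound C, ?_, ?_, ?_⟩
  · refine Tendsto.congr' (failureBound_eventuallyEq hC).symm ?_
    simpa using (tendsto_log_natCast.const_div_atTop 100).add (hC.const_div_atTop 2)
  · intro hCeq
    have hev := failureBound_eventuallyEq hC
    have hlog := tendsto_log_natCast.eventually_ge_atTop 128
    constructor
    · refine IsBigO.of_bound 102 ?_
      filter_upwards [hev, hlog] with d h1 h2
      have h0 : 0 < Real.log d := by linarith
      rw [h1, hCeq, Real.norm_of_nonneg (by positivity), Real.norm_of_nonneg (by positivity)]
      have : 2 / Real.log d ^ 2 ≤ 2 / Real.log d := by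
        gcongr
        nlinarith
      calc _ ≤ 100 / Real.log d + 2 / Real.log d := by simpa using this
        _ = 102 * (1 / Real.log d) := by ring
    · refine IsBigO.of_bound 1 ?_
      filter_upwards [hev, hlog] with d h1 h2
      have h0 : 0 < Real.log d := by linarith
      rw [h1, hCeq, Real.norm_of_nonneg (by positivity), Real.norm_of_nonneg (by positivity),
        one_mul]
      have : 0 ≤ 2 / Real.log d ^ 2 := by positivity
      have : 1 / Real.log d ≤ 100 / Real.log d := by gcongr; norm_num
      simp only
      linarith
  · intro d n κ σ ε M hκ hσ hn hε hM
    rw [failureBound]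
    split_ifs with hd
    · have hd0 : 0 < d := by
        rcases Nat.eq_zero_or_pos d with h | h
        · rw [h] at hd; norm_num at hd
        · exact h
      have hd' : (0 : ℝ) < d := by exact_mod_cast hd0
      have hp : NoiseParams d n (Real.log d) κ σ ε (σ ^ 2 * κ * Real.log d) := by
        refine ⟨hd0, hn, hκ, hσ, hd.1, ?_, rfl, ?_⟩
        · linarith [Real.log_le_sub_one_of_pos hd']
        · rw [hε, Real.rpow_def_of_pos hd']
          congr 2
          ring
      exact hp.le_measureReal hM hd.2
    · rw [sub_self]
      exact measureReal_nonneg
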